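/- Let $G$ be a finite connected graph (multiple edges allowed) with oriented edge set $E$ and two distinct external vertices $u,w$; an external momentum $p\in\mathbb R^d$ ($d\ge 1$) enters at $u$ and leaves at $w$. Let $L$ be the number of loops of $G$. Using a $\mathbb Z$-basis $c_1,\dots,c_L$ of the lattice of integral circulations of $G$ and a flow $q$ of unit strength from $u$ to $w$, write the edge momenta as $p_e=\sum_l c_l(e)k_l+q(e)\,p$ with loop momenta $k_l\in\mathbb R^d$. Let $S$ be a finite set and, for $s\in S$, let $(s_0,s_1)\in E^2$; the numerator is $\prod_{s\in S}p_{s_0}\cdot p_{s_1}$. Let $\beta_e>0$ be the exponents of the massless propagators $(p_e^2)^{-\beta_e}$, and suppose that $\beta_0$, defined by $$\beta_0+\sum_{e\in E}\beta_e=(L+1)\tfrac d2+\#S ,$$ is positive. Let $\tilde G$ be the completed graph, obtained from $G$ by adding an edge $0$ from $w$ to $u$; it has $L+1$ loops. For positive $a=(a_e)_{e\in E}$ put $$N_G(p,a)=\int\prod_{l=1}^L\frac{d^dk_l}{\pi^{d/2}}\ \prod_{s\in S}(p_{s_0}\cdot p_{s_1})\ e^{-\sum_e a_ep_e^2},\qquad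 \mathcal I_G(p)=\frac1{\prod_e\Gamma(\beta_e)}\int_{(0,\infty)^E}\prod_e da_e\,a_e^{\beta_e-1}\,N_G(p,a),$$ and, for positive $\tilde a=(a_0,a)$, let $I_{\tilde G}(\tilde a)=\Gamma(\tfrac d2)\,N_{\tilde G}(\tilde a)$ be the integrand of the vacuum graph $\tilde G$, where $N_{\tilde G}$ is the same Gaussian integral over the $L+1$ loop momenta of $\tilde G$ (for any $\mathbb Z$-basis of its integral circulations), with the same numerator and without external momentum. 1. For every $p$ for which no $p_e$ vanishes on a set of loop momenta of positive measure and the momentum space integral converges absolutely, the integral defining $\mathcal I_G(p)$ converges absolutely, and $$\int\prod_{l}\frac{d^dk_l}{\pi^{d/2}}\ \frac{\prod_{s}p_{s_0}\cdot p_{s_1}}{\prod_e(p_e^2)^{\beta_e}}=\mathcal I_G(p).$$ 2. Suppose that the integral over $a$ defining $\mathcal I_G(p)$ converges absolutely for some $p\ne0$. Then it does so for every $p\neq 0$, and there is a constant $R$ (the residue of $G$) with $\mathcal I_G(p)=R\,(p^2)^{\beta_0-d/2}$ for all $p\ne0$. This residue is the parametric integral of the completed vacuum graph, in which the added edge carries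 the exponent $\beta_0$: $$R=\frac1{\Gamma(\beta_0)\prod_e\Gamma(\beta_e)}\int_{a_x>0}\ \prod_{x\in E\cup\{0\}}\bigl(da_x\,a_x^{\beta_x-1}\bigr)\ I_{\tilde G}(\tilde a)\ \delta\Bigl(\sum_{x\in T}a_x-1\Bigr)$$ for every non-empty $T\subseteq E\cup\{0\}$ (in particular with $a_0$ fixed to $1$), the integral being absolutely convergent. 3. Suppose in addition that the numerator is a single scalar product $p_i\cdot p_j$, $i,j\in E$. Let $M$ be the matrix of $\tilde G$ with blocks $\begin{pmatrix}\operatorname{diag}(\tilde a)&\varepsilon\\-\varepsilon^{T}&0\end{pmatrix}$, where $\varepsilon$ is the incidence matrix ($+1$ at the target and $-1$ at the source of an edge) with the column of an arbitrary vertex removed; let $\tilde U=\det M$, and let $\tilde U^{i,j}$ be the determinant of $M$ with the row $i$ replaced by the row whose only nonzero entry is a $1$ in column $j$. Then, for all positive $\tilde a$, $$\tilde U(\tilde a)>0,\qquad I_{\tilde G}(\tilde a)=\Gamma(\tfrac d2+1)\,\frac{\tilde U^{i,j}}{\tilde U^{d/2+1}},$$ and, for every non-empty $T\subseteq E\cup\{0\}$,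 with absolute convergence, $$R=\frac{\Gamma(\frac d2+1)}{\Gamma(\beta_0)\prod_e\Gamma(\beta_e)}\int_{a_x>0}\ \prod_{x\in E\cup\{0\}}\bigl(da_x\,a_x^{\beta_x-1}\bigr)\ \frac{\tilde U^{i,j}}{\tilde U^{d/2+1}}\ \delta\Bigl(\sum_{x\in T}a_x-1\Bigr).$$ -/

import Mathlib

open MeasureTheory
open scoped Matrix

/-- A multigraph with vertices `V` and oriented edges `E`
(multiple edges and self-loops are allowed). -/
structure FeynGraph (V E : Type*) where
  src : E → V
  tgt : E → V

namespace FeynGraph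

variable {V E : Type*}

/-- Any two vertices are joined by an unoriented path of edges. -/
def Connected (G : FeynGraph V E) : Prop :=
  ∀ x y : V, Relation.EqvGen (fun x y => ∃ e, G.src e = x ∧ G.tgt e = y) x y

/-- The incidence matrix: `+1` at the target of an edge, `-1` at its source
(and `0` for a self-loop). -/
def incidence [DecidableEq V] (G : FeynGraph V E) (R : Type*) [Ring R] : Matrix E V R :=
  Matrix.of fun e v => (if G.tgt e = v then 1 else 0) - (if G.src e = v then 1 else 0)

/-- The lattice `H₁(G, ℤ)` of integral circulations on the graph. -/
def cycleLattice [Fintype E] [DecidableEq V] (G : FeynGraph V E) : Submodule ℤ (E → ℤ) :=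
  LinearMap.ker (G.incidence ℤ)ᵀ.mulVecLin

/-- The completed graph: one more edge `none`, going from the exit vertex `w` of the external
momentum back to its entry vertex `u`. -/
def completed (G : FeynGraph V E) (u w : V) : FeynGraph V (Option E) where
  src x := x.elim w G.src
  tgt x := x.elim u G.tgt

/-- The graph matrix `M_G` (row and column of the vertex `v₀` removed), evaluated at the
Schwinger parameters `a`. -/
def graphMatrix [DecidableEq V] [DecidableEq E] (G : FeynGraph V E) (v₀ : V) (a : E → ℝ) :
    Matrix (E ⊕ {v : V // v ≠ v₀}) (E ⊕ {v : V // v ≠ v₀}) ℝ :=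
  Matrix.fromBlocks (Matrix.diagonal a) ((G.incidence ℝ).submatrix id Subtype.val)
    (-((G.incidence ℝ).submatrix id Subtype.val)ᵀ) 0

/-- The first Symanzik polynomial `U`, evaluated at `a`. -/
noncomputable def symanzik [Fintype V] [Fintype E] [DecidableEq V] [DecidableEq E]
    (G : FeynGraph V E) (v₀ : V) (a : E → ℝ) : ℝ :=
  (G.graphMatrix v₀ a).det

/-- The polynomial `U^{i,j}`, evaluated at `a`: the determinant of the graph matrix in which the
row of the edge `i` is replaced by the row whose only nonzero entry is a `1` in column `j`. -/
noncomputable def dodgson [Fintype V] [Fintype E] [DecidableEq V] [DecidableEq E]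
    (G : FeynGraph V E) (v₀ : V) (i j : E) (a : E → ℝ) : ℝ :=
  ((G.graphMatrix v₀ a).updateRow (Sum.inl i) (Pi.single (Sum.inl j) 1)).det

end FeynGraph

section Integrals

variable {E S : Type*} [Fintype E] [Fintype S] {L : ℕ} (d : ℕ)

/-- The momentum in the edge `e`, for loop momenta `k` along the cycles `c` and an external
momentum `p` routed along `q`. -/
noncomputable def edgeMomentum (c : Fin L → E → ℤ) (q : E → ℝ)
    (p : EuclideanSpace ℝ (Fin d)) (k : Fin L → EuclideanSpace ℝ (Fin d)) (e : E) :
    EuclideanSpace ℝ (Fin d) :=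
  ∑ l, (c l e : ℝ) • k l + q e • p

/-- The product of scalar products `∏ₛ P_{s₀} ⬝ P_{s₁}` of edge momenta `P`. -/
noncomputable def momentumNumerator (s : S → E × E) (P : E → EuclideanSpace ℝ (Fin d)) : ℝ :=
  ∏ x, inner ℝ (P (s x).1) (P (s x).2)

/-- The momentum space integrand: numerator times the massless propagators `(P_e²)^{-β_e}`. -/
noncomputable def momentumIntegrand (β : E → ℝ) (s : S → E × E) (P : E → EuclideanSpace ℝ (Fin d)) :
    ℝ :=
  momentumNumerator d s P * ∏ e, ((‖P e‖ ^ 2) ^ β e)⁻¹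

/-- The momentum space Feynman integral, with loop measure `∏ dᵈk / π^{d/2}`. -/
noncomputable def momentumIntegral (c : Fin L → E → ℤ) (q : E → ℝ) (β : E → ℝ) (s : S → E × E)
    (p : EuclideanSpace ℝ (Fin d)) : ℝ :=
  (Real.pi ^ ((L : ℝ) * d / 2))⁻¹ *
    ∫ k : Fin L → EuclideanSpace ℝ (Fin d), momentumIntegrand d β s (edgeMomentum d c q p k)

/-- Absolute convergence of the momentum space integral, including that the integrand is almost
everywhere defined. -/
def MomentumConvergent (c : Fin L → E → ℤ) (q : E → ℝ) (β : E → ℝ) (s : S → E × E)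
    (p : EuclideanSpace ℝ (Fin d)) : Prop :=
  (∀ᵐ k : Fin L → EuclideanSpace ℝ (Fin d), ∀ e, edgeMomentum d c q p k e ≠ 0) ∧
    Integrable fun k : Fin L → EuclideanSpace ℝ (Fin d) =>
      momentumIntegrand d β s (edgeMomentum d c q p k)

/-- The Gaussian integral over the loop momenta at fixed Schwinger parameters `a`, with loop
measure `∏ dᵈk / π^{d/2}`. -/
noncomputable def gaussianLoopIntegral (c : Fin L → E → ℤ) (q : E → ℝ) (s : S → E × E)
    (p : EuclideanSpace ℝ (Fin d)) (a : E → ℝ) : ℝ :=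
  (Real.pi ^ ((L : ℝ) * d / 2))⁻¹ *
    ∫ k : Fin L → EuclideanSpace ℝ (Fin d), momentumNumerator d s (edgeMomentum d c q p k) *
      Real.exp (-∑ e, a e * ‖edgeMomentum d c q p k e‖ ^ 2)

/-- The integrand of the Schwinger parametric representation of the diagram. -/
noncomputable def schwingerIntegrand (c : Fin L → E → ℤ) (q : E → ℝ) (β : E → ℝ) (s : S → E × E)
    (p : EuclideanSpace ℝ (Fin d)) (a : E → ℝ) : ℝ :=
  (∏ e, a e ^ (β e - 1)) * gaussianLoopIntegral d c q s p a

/-- Absolute convergence of the Schwinger parametric representation. -/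
def SchwingerConvergent (c : Fin L → E → ℤ) (q : E → ℝ) (β : E → ℝ) (s : S → E × E)
    (p : EuclideanSpace ℝ (Fin d)) : Prop :=
  IntegrableOn (schwingerIntegrand d c q β s p) {a | ∀ e, 0 < a e}

/-- The Feynman integral in the Schwinger parametric representation. -/
noncomputable def schwingerIntegral (c : Fin L → E → ℤ) (q : E → ℝ) (β : E → ℝ) (s : S → E × E)
    (p : EuclideanSpace ℝ (Fin d)) : ℝ :=
  (∏ e, Real.Gamma (β e))⁻¹ * ∫ a in {a : E → ℝ | ∀ e, 0 < a e}, schwingerIntegrand d c q β s p a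

/-- The integrand of a massless vacuum diagram with numerator: the Gaussian integral over all its
loop momenta, without external momentum, times `Γ(d/2)`. -/
noncomputable def vacuumIntegrand (c : Fin L → E → ℤ) (s : S → E × E) (a : E → ℝ) : ℝ :=
  Real.Gamma ((d : ℝ) / 2) * gaussianLoopIntegral d c 0 s 0 a

end Integrals

section Projective

variable {F : Type*} [Fintype F] [DecidableEq F]

/-- The point of the hyperplane `∑_{x ∈ T} a_x = 1` with coordinates `b` off `x₀`
(for `x₀ ∈ T`). -/
def slicePoint (T : Finset F) (x₀ : F) (b : {x : F // x ≠ x₀} → ℝ) : F → ℝ :=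
  fun x => if h : x = x₀ then 1 - ∑ y : {x : F // x ≠ x₀}, (if y.1 ∈ T then b y else 0)
    else b ⟨x, h⟩

/-- The part of that hyperplane in the open positive orthant, in the same coordinates. -/
def positiveSlice (T : Finset F) (x₀ : F) : Set ({x : F // x ≠ x₀} → ℝ) :=
  {b | ∀ x, 0 < slicePoint T x₀ b x}

/-- Absolute convergence of `∫ ∏ da_x f(a) δ(∑_{x ∈ T} a_x - 1)` over the positive orthant, the
delta function being used to eliminate the variable `a_{x₀}`, `x₀ ∈ T`. -/
def DeltaIntegrable (T : Finset F) (x₀ : F) (f : (F → ℝ) → ℝ) : Prop :=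
  IntegrableOn (fun b => f (slicePoint T x₀ b)) (positiveSlice T x₀)

/-- The integral `∫ ∏ da_x f(a) δ(∑_{x ∈ T} a_x - 1)` over the positive orthant, the
delta function being used to eliminate the variable `a_{x₀}`, `x₀ ∈ T`. -/
noncomputable def deltaIntegral (T : Finset F) (x₀ : F) (f : (F → ℝ) → ℝ) : ℝ :=
  ∫ b in positiveSlice T x₀, f (slicePoint T x₀ b)

end Projective

/-! The momentum space statement is Schwinger's trick: each propagator is a Gamma integral, and
Tonelli shows that the joint integrand in `(k, a)` is absolutely integrable exactly because the
momentum integrand is (`schwinger_of_momentum`).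

For the residue, the loop integral `N_G(p, a)` is invariant under isometries of `p`, and scaling `p`
amounts to scaling `a`. Hence `I_G(p) = R (p²)^(β₀ - d/2)`, the exponent being forced by the
relation that defines `β₀`. Average this power law against `exp(-p²)`. On one side polar coordinates
give `R π^(d/2) Γ(β₀) / Γ(d/2)`, which is finite because `β₀ > 0`. On the other side, exchanging the
integrals makes `p` one more loop momentum, the one flowing through the added edge, and `exp(-p²)`
is that edge's Gaussian factor at `a₀ = 1`. So the average is the parametric integral of the
completed graph with `a₀` fixed to `1`, and `Γ(d/2)` is the factor built into the vacuum integrand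
(`gaussian_average_schwinger`, `vacuumIntegrand_completed`).

The vacuum integrand times the powers of the parameters is homogeneous of degree minus the number of
edges of the completed graph. The choice of hyperplane is then immaterial (Cheng–Wu): every slice
integral equals one integral over the whole orthant, with a weight that does not mention the slice
(`lintegral_positiveSlice`).

For one scalar product, let `C` be the matrix of a cycle basis and `Λ = Cᵀ diag(a) C`. The Gaussian
integral is `(d/2) (C Λ⁻¹ Cᵀ)_{ji} / det Λ^(d/2)`. A lattice basis of circulations has an integral
unimodular complement (`exists_unimodular_frame`), so `det M = det Λ` without any constant, and `C
Λ⁻¹ Cᵀ` is the edge block of `M⁻¹`, whose entries are `U^{i,j} / U`. -/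

namespace FeynGraph

/-! ### Flows, circulations and integral bases of chains -/

variable {V E : Type*}

theorem incidence_map [DecidableEq V] (G : FeynGraph V E) :
    (G.incidence ℤ).map (Int.cast : ℤ → ℝ) = G.incidence ℝ := by
  ext e v
  simp [incidence, apply_ite (Int.cast : ℤ → ℝ)]

/-- In a connected graph, one unit can be routed from any vertex to any other. -/
theorem Connected.exists_flow [Fintype E] [DecidableEq E] [DecidableEq V] {G : FeynGraph V E}
    (hG : G.Connected) (x y : V) :
    ∃ f : E → ℤ, (G.incidence ℤ)ᵀ *ᵥ f = Pi.single y 1 - Pi.single x 1 := by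
  induction hG x y with
  | rel x y h =>
    obtain ⟨e, rfl, rfl⟩ := h
    refine ⟨Pi.single e 1, ?_⟩
    ext v
    simp [incidence, Pi.single_apply, eq_comm]
  | refl x => exact ⟨0, by simp⟩
  | symm x y _ ih =>
    obtain ⟨f, hf⟩ := ih
    exact ⟨-f, by rw [Matrix.mulVec_neg, hf]; abel⟩
  | trans x y z _ _ ih₁ ih₂ =>
    obtain ⟨f, hf⟩ := ih₁
    obtain ⟨g, hg⟩ := ih₂
    exact ⟨f + g, by rw [Matrix.mulVec_add, hf, hg]; abel⟩

theorem mem_cycleLattice [Fintype E] [DecidableEq V] (G : FeynGraph V E) (f : E → ℤ) :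
    f ∈ G.cycleLattice ↔ (G.incidence ℤ)ᵀ *ᵥ f = 0 := Iff.rfl

theorem sum_incidence [Fintype V] [DecidableEq V] (G : FeynGraph V E) (e : E) :
    ∑ v, G.incidence ℤ e v = 0 := by
  simp [incidence]

/-- Conservation of the flow at all vertices but one implies it at that vertex too. -/
theorem mem_cycleLattice_of_ne [Fintype V] [Fintype E] [DecidableEq V] (G : FeynGraph V E)
    (v₀ : V) (f : E → ℤ) (h : ∀ v, v ≠ v₀ → ((G.incidence ℤ)ᵀ *ᵥ f) v = 0) :
    f ∈ G.cycleLattice := by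
  rw [mem_cycleLattice]
  have hs : ∑ v, ((G.incidence ℤ)ᵀ *ᵥ f) v = 0 := by
    simp only [Matrix.mulVec, dotProduct, Matrix.transpose_apply]
    rw [Finset.sum_comm]
    exact Finset.sum_eq_zero fun e _ => by rw [← Finset.sum_mul, sum_incidence, zero_mul]
  ext v
  by_cases hv : v = v₀
  · subst hv
    rwa [Finset.sum_eq_single v (fun b _ hb => h b hb) (by simp)] at hs
  · exact h v hv

/-- The incidence matrix with the column of the vertex `v₀` removed. -/
def reducedIncidence [DecidableEq V] (G : FeynGraph V E) (R : Type*) [Ring R] (v₀ : V) :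
    Matrix E {v : V // v ≠ v₀} R :=
  (G.incidence R).submatrix id Subtype.val

/-- The matrix whose columns are the members of a family of circulations. -/
def cycleMatrix {ι : Type*} (c : ι → E → ℤ) : Matrix E ι ℤ :=
  Matrix.of fun e l => c l e

/-- A basis of the lattice of circulations of a connected graph is complemented, in the lattice of
all integral chains, by chains dual to the columns of the reduced incidence matrix. -/
theorem exists_unimodular_frame [Fintype V] [Fintype E] [DecidableEq V] [DecidableEq E]
    {G : FeynGraph V E} (hG : G.Connected) {ι : Type*} [Fintype ι] [DecidableEq ι]
    (c : Module.Basis ι ℤ G.cycleLattice) (v₀ : V) :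
    ∃ (Y : Matrix ι E ℤ) (D : Matrix E {v : V // v ≠ v₀} ℤ),
      cycleMatrix (fun l => (c l : E → ℤ)) * Y + D * (G.reducedIncidence ℤ v₀)ᵀ = 1 ∧
      Y * cycleMatrix (fun l => (c l : E → ℤ)) = 1 ∧ Y * D = 0 ∧
      (G.reducedIncidence ℤ v₀)ᵀ * D = 1 ∧
      (G.reducedIncidence ℤ v₀)ᵀ * cycleMatrix (fun l => (c l : E → ℤ)) = 0 := by
  -- Column `v` of `D` carries one unit from `v₀` to `v`; with the coordinate `v₀` deleted its
  -- boundary is a standard basis vector.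
  choose D' hD' using fun v => hG.exists_flow v₀ v
  set D : Matrix E {v : V // v ≠ v₀} ℤ := Matrix.of fun e v => D' v e with hD
  set ε := G.reducedIncidence ℤ v₀ with hε
  set C := cycleMatrix (fun l => (c l : E → ℤ)) with hC
  have hεD : εᵀ * D = 1 := by
    ext v v'
    have := congrFun (hD' v') v
    simp only [Matrix.mulVec, dotProduct] at this
    simp only [Matrix.mul_apply, hε, reducedIncidence, hD, Matrix.transpose_apply,
      Matrix.submatrix_apply, id, Matrix.of_apply] at this ⊢
    rw [this]
    simp [Matrix.one_apply, Pi.single_apply, v.2, Subtype.ext_iff]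
  have hεC : εᵀ * C = 0 := by
    ext v l
    exact congrFun ((G.mem_cycleLattice _).1 (c l).2) v
  -- `1 - D εᵀ` projects chains onto circulations. `Y` records the coordinates of its columns in the
  -- given basis.
  have hmem : ∀ e, (1 - D * εᵀ).col e ∈ G.cycleLattice := by
    intro e
    refine G.mem_cycleLattice_of_ne v₀ _ fun v hv => ?_
    have : εᵀ * (1 - D * εᵀ) = 0 := by
      rw [Matrix.mul_sub, ← Matrix.mul_assoc, hεD]; simp
    exact congrFun (congrFun this ⟨v, hv⟩) e
  set Y : Matrix ι E ℤ := Matrix.of fun l e => c.repr ⟨_, hmem e⟩ l with hY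
  have h1 : C * Y + D * εᵀ = 1 := by
    rw [← eq_sub_iff_add_eq]
    ext e e'
    have := congrArg (fun z : G.cycleLattice => (z : E → ℤ) e) (c.sum_repr ⟨_, hmem e'⟩)
    simp only [Submodule.coe_sum, Submodule.coe_smul, Finset.sum_apply, Pi.smul_apply,
      smul_eq_mul] at this
    rw [Matrix.mul_apply]
    refine Eq.trans (Finset.sum_congr rfl fun l _ => ?_) this
    simp [hC, hY, cycleMatrix, mul_comm]
  -- Independence of the basis allows `C` to be cancelled on the left, which reduces `Y C = 1` and
  -- `Y D = 0` to `C Y C = C` and `C Y D = 0`.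
  have hinj : ∀ x x' : ι → ℤ, C *ᵥ x = C *ᵥ x' → x = x' := by
    intro x x' h
    have hli := c.linearIndependent
    rw [Fintype.linearIndependent_iff] at hli
    ext l
    have := hli (fun l => x l - x' l) (by
      ext e
      have := congrFun h e
      simp only [Matrix.mulVec, dotProduct, hC, cycleMatrix, Matrix.of_apply] at this
      simpa [Finset.sum_apply, sub_mul, Finset.sum_sub_distrib, mul_comm _ ((c _ : E → ℤ) e),
        sub_eq_zero] using this) l
    linarith
  have hCY : C * Y = 1 - D * εᵀ := eq_sub_iff_add_eq.2 h1
  have hCYC : C * (Y * C) = C * (1 : Matrix ι ι ℤ) := by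
    rw [← Matrix.mul_assoc, hCY, Matrix.sub_mul, Matrix.mul_assoc D, hεC]; simp
  have hCYD : C * (Y * D) = C * (0 : Matrix ι {v : V // v ≠ v₀} ℤ) := by
    rw [← Matrix.mul_assoc, hCY, Matrix.sub_mul, Matrix.mul_assoc D, hεD]; simp
  refine ⟨Y, D, h1, ?_, ?_, hεD, hεC⟩
  · ext l k
    exact congrFun (hinj ((Y * C).col k) ((1 : Matrix ι ι ℤ).col k)
      (funext fun e => congrFun (congrFun hCYC e) k)) l
  · ext l k
    exact congrFun (hinj ((Y * D).col k) ((0 : Matrix ι _ ℤ).col k)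
      (funext fun e => congrFun (congrFun hCYD e) k)) l

end FeynGraph

/-! ### Determinant and inverse of a bordered matrix -/

section BlockDeterminants

variable {m n ι : Type*} [Fintype m] [Fintype n] [Fintype ι] [DecidableEq m] [DecidableEq n]
  [DecidableEq ι]

theorem Matrix.map_intCast_mul {m n o : Type*} [Fintype n] (A : Matrix m n ℤ) (B : Matrix n o ℤ) :
    (A * B).map (Int.cast : ℤ → ℝ) = A.map (Int.cast : ℤ → ℝ) * B.map (Int.cast : ℤ → ℝ) :=
  Matrix.map_mul (f := Int.castRingHom ℝ)

/-- An integral matrix with a two-sided integral inverse preserves the determinant of quadratic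
forms. -/
theorem Matrix.det_transpose_mul_mul_of_int_inverse {B : Matrix m n ℤ} {B' : Matrix n m ℤ}
    (h : B * B' = 1) (h' : B' * B = 1) (A : Matrix m m ℝ) :
    ((B.map (Int.cast : ℤ → ℝ))ᵀ * A * B.map (Int.cast : ℤ → ℝ)).det = A.det := by
  have hR : B.map (Int.cast : ℤ → ℝ) * B'.map (Int.cast : ℤ → ℝ) = 1 := by
    rw [← Matrix.map_intCast_mul, h]; simp
  have hR' : B'.map (Int.cast : ℤ → ℝ) * B.map (Int.cast : ℤ → ℝ) = 1 := by
    rw [← Matrix.map_intCast_mul, h']; simp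
  -- Rows and columns of `B` have different index types, so `B` has no determinant. `B Bᵀ` has one;
  -- it is an integral unit and nonnegative, hence `1`.
  have hdet : (B.map (Int.cast : ℤ → ℝ) * (B.map (Int.cast : ℤ → ℝ))ᵀ).det = 1 := by
    have hu : IsUnit (B * Bᵀ).det := by
      refine IsUnit.of_mul_eq_one (B'ᵀ * B').det ?_
      rw [← Matrix.det_mul, Matrix.mul_assoc, ← Matrix.mul_assoc Bᵀ, ← Matrix.transpose_mul, h']
      simp [h]
    have hcast : (B.map (Int.cast : ℤ → ℝ) * (B.map (Int.cast : ℤ → ℝ))ᵀ).det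
        = ((B * Bᵀ).det : ℝ) := by
      rw [← Matrix.transpose_map, ← Matrix.map_intCast_mul]
      exact ((Int.castRingHom ℝ).map_det (B * Bᵀ)).symm
    have hnn : 0 ≤ (B.map (Int.cast : ℤ → ℝ) * (B.map (Int.cast : ℤ → ℝ))ᵀ).det :=
      (Matrix.posSemidef_self_mul_conjTranspose (B.map (Int.cast : ℤ → ℝ))).det_nonneg
    rw [hcast] at hnn ⊢
    rcases Int.isUnit_iff.1 hu with h1 | h1
    · rw [h1]; simp
    · rw [h1] at hnn; norm_num at hnn
  rw [← Matrix.det_comm' (M' := B'.map (Int.cast : ℤ → ℝ)) hR hR', ← Matrix.mul_assoc,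
    Matrix.det_mul, hdet, one_mul]

/-- The determinant of a bordered diagonal matrix, in terms of a unimodular complement of the
border. -/
theorem Matrix.det_fromBlocks_border {C : Matrix m ι ℤ} {D ε : Matrix m n ℤ} {Y : Matrix ι m ℤ}
    (h1 : C * Y + D * εᵀ = 1) (hYC : Y * C = 1) (hYD : Y * D = 0) (hεD : εᵀ * D = 1)
    (hεC : εᵀ * C = 0) {a : m → ℝ} (ha : ∀ x, a x ≠ 0) :
    (Matrix.fromBlocks (Matrix.diagonal a) (ε.map (Int.cast : ℤ → ℝ))
      (-(ε.map (Int.cast : ℤ → ℝ))ᵀ) 0).det =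
    ((C.map (Int.cast : ℤ → ℝ))ᵀ * Matrix.diagonal a * C.map (Int.cast : ℤ → ℝ)).det := by
  have hB : Matrix.fromCols C D * Matrix.fromRows Y εᵀ = 1 := by
    rw [Matrix.fromCols_mul_fromRows, h1]
  have hB' : Matrix.fromRows Y εᵀ * Matrix.fromCols C D = 1 := by
    rw [Matrix.fromRows_mul_fromCols, hYC, hYD, hεC, hεD, Matrix.fromBlocks_one]
  have hdet := fun A => Matrix.det_transpose_mul_mul_of_int_inverse hB hB' A
  have e2 := congrArg (fun X => X.map (Int.cast : ℤ → ℝ)) hYC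
  have e4 := congrArg (fun X => X.map (Int.cast : ℤ → ℝ)) hεD
  have e5 := congrArg (fun X => X.map (Int.cast : ℤ → ℝ)) hεC
  simp only [Matrix.map_intCast_mul, Matrix.transpose_map] at e2 e4 e5
  have e6 := congrArg (fun X => X.map (Int.cast : ℤ → ℝ)) hB
  simp only [Matrix.map_intCast_mul] at e6
  have hfc : (Matrix.fromCols C D).map (Int.cast : ℤ → ℝ)
      = Matrix.fromCols (C.map Int.cast) (D.map Int.cast) := by
    ext i (j | j) <;> rfl
  have hfr : (Matrix.fromRows Y εᵀ).map (Int.cast : ℤ → ℝ)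
      = Matrix.fromRows (Y.map Int.cast) (ε.map Int.cast)ᵀ := by
    ext (i | i) j <;> rfl
  rw [hfc, hfr] at e6
  rw [hfc] at hdet
  rw [Matrix.map_one _ Int.cast_zero Int.cast_one] at e2 e4 e6
  rw [Matrix.map_zero _ Int.cast_zero] at e5
  generalize C.map (Int.cast : ℤ → ℝ) = c at *
  generalize D.map (Int.cast : ℤ → ℝ) = δ at *
  generalize Y.map (Int.cast : ℤ → ℝ) = y at *
  generalize ε.map (Int.cast : ℤ → ℝ) = ϵ at *
  have hA : Matrix.diagonal a * Matrix.diagonal a⁻¹ = 1 := by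
    rw [Matrix.diagonal_mul_diagonal]
    simp [ha]
  generalize Matrix.diagonal a⁻¹ = A' at *
  generalize Matrix.diagonal a = A at *
  let _ : Invertible A := ⟨A', mul_eq_one_comm.1 hA, hA⟩
  have hinv : ⅟A = A' := rfl
  rw [Matrix.det_fromBlocks₁₁, hinv]
  -- The Schur complement has reduced the goal to `det A * det (εᵀ A⁻¹ ε) = det (Cᵀ A C)`. Compare
  -- the unimodular frame `F = (C | D)` with `(C | A⁻¹ ε)`: pairing the two through `A` is block
  -- triangular with determinant `det (Cᵀ A C)`, and `F⁻¹ (C | A⁻¹ ε)` is block triangular with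
  -- determinant `det (εᵀ A⁻¹ ε)`.
  have hK : (Matrix.fromCols c δ)ᵀ * A * Matrix.fromCols c (A' * ϵ)
      = Matrix.fromBlocks (cᵀ * A * c) 0 (δᵀ * A * c) 1 := by
    have h5 : cᵀ * ϵ = 0 := by rw [← Matrix.transpose_transpose ϵ, ← Matrix.transpose_mul, e5]; simp
    have h4 : δᵀ * ϵ = 1 := by rw [← Matrix.transpose_transpose ϵ, ← Matrix.transpose_mul, e4]; simp
    rw [Matrix.transpose_fromCols, Matrix.fromRows_mul, Matrix.fromRows_mul_fromCols]
    congr 1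
    · rw [Matrix.mul_assoc, ← Matrix.mul_assoc A, hA, Matrix.one_mul, h5]
    · rw [Matrix.mul_assoc, ← Matrix.mul_assoc A, hA, Matrix.one_mul, h4]
  have hS : Matrix.fromRows y ϵᵀ * Matrix.fromCols c (A' * ϵ)
      = Matrix.fromBlocks 1 (y * (A' * ϵ)) 0 (ϵᵀ * (A' * ϵ)) := by
    rw [Matrix.fromRows_mul_fromCols, e2, e5]
  have hdet' := congrArg Matrix.det hK
  rw [Matrix.det_fromBlocks_zero₁₂, Matrix.det_one, mul_one] at hdet'
  rw [← hdet', ← Matrix.one_mul (Matrix.fromCols c (A' * ϵ)), ← e6,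
    Matrix.mul_assoc _ _ (Matrix.fromCols c (A' * ϵ)), hS, ← Matrix.mul_assoc, Matrix.det_mul, hdet,
    Matrix.det_fromBlocks_zero₂₁, Matrix.det_one, one_mul]
  simp [Matrix.mul_assoc]

/-- The inverse of a bordered matrix, in terms of a basis of the kernel of the border. -/
theorem Matrix.adjugate_fromBlocks_border {C : Matrix m ι ℝ} {D ε : Matrix m n ℝ}
    {Y : Matrix ι m ℝ} (h1 : C * Y + D * εᵀ = 1) (hεC : εᵀ * C = 0) (A : Matrix m m ℝ)
    (hΛ : IsUnit (Cᵀ * A * C).det) (i j : m) :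
    (Matrix.fromBlocks A ε (-εᵀ) 0).adjugate (Sum.inl i) (Sum.inl j) =
      (Matrix.fromBlocks A ε (-εᵀ) 0).det * (C * (Cᵀ * A * C)⁻¹ * Cᵀ) i j := by
  set X := C * (Cᵀ * A * C)⁻¹ * Cᵀ with hX
  set M := Matrix.fromBlocks A ε (-εᵀ) 0 with hM
  have h1' : Yᵀ * Cᵀ + ε * Dᵀ = 1 := by
    simpa using congrArg Matrix.transpose h1
  have hCX : Cᵀ * (1 - A * X) = 0 := by
    rw [Matrix.mul_sub, hX, ← Matrix.mul_assoc, ← Matrix.mul_assoc, ← Matrix.mul_assoc,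
      Matrix.mul_nonsing_inv _ hΛ]
    simp
  -- The lower block is chosen to solve the upper equation: `ε Dᵀ = 1 - Yᵀ Cᵀ` acts as the identity
  -- on `1 - A X`, which `Cᵀ` annihilates.
  have hMX : M * Matrix.fromRows X (Dᵀ * (1 - A * X)) = Matrix.fromRows 1 0 := by
    rw [hM, Matrix.fromBlocks_mul_fromRows]
    congr 1
    · rw [← Matrix.mul_assoc ε, eq_sub_iff_add_eq'.2 h1', Matrix.sub_mul, Matrix.mul_assoc, hCX]
      simp
    · simp [hX, ← Matrix.mul_assoc, hεC]
  have := congrArg (fun Z => M.adjugate * Z) hMX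
  simp only [← Matrix.mul_assoc, Matrix.adjugate_mul] at this
  have := congrFun (congrFun this (Sum.inl i)) j
  simpa [Matrix.mul_apply, Matrix.one_apply, Fintype.sum_sum_type] using this.symm

end BlockDeterminants

/-! ### Symanzik polynomials through the loop matrix; cycles of the completed graph -/

namespace FeynGraph

variable {V E : Type*}

/-- The matrix of the quadratic form `∑ₑ aₑ pₑ²` in the loop momenta. -/
def loopMatrix [Fintype E] [DecidableEq E] {ι : Type*} (c : ι → E → ℤ) (a : E → ℝ) :
    Matrix ι ι ℝ :=
  ((cycleMatrix c).map (Int.cast : ℤ → ℝ))ᵀ * Matrix.diagonal a *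
    (cycleMatrix c).map (Int.cast : ℤ → ℝ)

variable [Fintype V] [Fintype E] [DecidableEq V] [DecidableEq E] {G : FeynGraph V E}

/-- The members of a basis of the lattice of circulations have an integral dual family. -/
theorem exists_left_inverse_cycleMatrix (hG : G.Connected) (v₀ : V) {ι : Type*} [Fintype ι]
    [DecidableEq ι] (c : Module.Basis ι ℤ G.cycleLattice) :
    ∃ Y : Matrix ι E ℝ, Y * (cycleMatrix (fun l => (c l : E → ℤ))).map (Int.cast : ℤ → ℝ) = 1 := by
  obtain ⟨Y, D, -, h, -⟩ := exists_unimodular_frame hG c v₀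
  refine ⟨Y.map Int.cast, ?_⟩
  rw [← Matrix.map_intCast_mul, h, Matrix.map_one _ Int.cast_zero Int.cast_one]

theorem graphMatrix_eq {V E : Type*} [DecidableEq V] [DecidableEq E] (G : FeynGraph V E) (v₀ : V)
    (a : E → ℝ) :
    G.graphMatrix v₀ a = Matrix.fromBlocks (Matrix.diagonal a)
      ((G.reducedIncidence ℤ v₀).map (Int.cast : ℤ → ℝ))
      (-((G.reducedIncidence ℤ v₀).map (Int.cast : ℤ → ℝ))ᵀ) 0 := by
  rw [graphMatrix, ← incidence_map]
  rfl

theorem loopMatrix_posDef (hG : G.Connected) (v₀ : V) {ι : Type*} [Fintype ι] [DecidableEq ι]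
    (c : Module.Basis ι ℤ G.cycleLattice) {a : E → ℝ} (ha : ∀ e, 0 < a e) :
    (loopMatrix (fun l => (c l : E → ℤ)) a).PosDef := by
  obtain ⟨Y, hY⟩ := exists_left_inverse_cycleMatrix hG v₀ c
  refine (Matrix.PosDef.diagonal ha).conjTranspose_mul_mul_same ?_
  intro x y h
  have : Y *ᵥ ((cycleMatrix (fun l => (c l : E → ℤ))).map (Int.cast : ℤ → ℝ) *ᵥ x) =
      Y *ᵥ ((cycleMatrix (fun l => (c l : E → ℤ))).map (Int.cast : ℤ → ℝ) *ᵥ y) :=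
    congrArg (fun z => Y *ᵥ z) h
  simpa only [Matrix.mulVec_mulVec, hY, Matrix.one_mulVec] using this

/-- The Symanzik polynomial is the determinant of the quadratic form in the loop momenta. -/
theorem symanzik_eq_det_loopMatrix (hG : G.Connected) (v₀ : V) {ι : Type*} [Fintype ι]
    [DecidableEq ι] (c : Module.Basis ι ℤ G.cycleLattice) {a : E → ℝ} (ha : ∀ e, 0 < a e) :
    G.symanzik v₀ a = (loopMatrix (fun l => (c l : E → ℤ)) a).det := by
  obtain ⟨Y, D, h1, h2, h3, h4, h5⟩ := exists_unimodular_frame hG c v₀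
  rw [symanzik, graphMatrix_eq, Matrix.det_fromBlocks_border h1 h2 h3 h4 h5 fun e => (ha e).ne']
  rfl

/-- Replacing row `i` by the unit row at `j` produces the adjugate entry `(j, i)`, so Cramer's rule
reads it off the edge block `C Λ⁻¹ Cᵀ` of the inverse of the graph matrix. -/
theorem dodgson_eq_symanzik_mul (hG : G.Connected) (v₀ : V) {ι : Type*} [Fintype ι]
    [DecidableEq ι] (c : Module.Basis ι ℤ G.cycleLattice) {a : E → ℝ} (ha : ∀ e, 0 < a e)
    (i j : E) :
    G.dodgson v₀ i j a = G.symanzik v₀ a *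
      ((cycleMatrix (fun l => (c l : E → ℤ))).map (Int.cast : ℤ → ℝ) *
        (loopMatrix (fun l => (c l : E → ℤ)) a)⁻¹ *
        ((cycleMatrix (fun l => (c l : E → ℤ))).map (Int.cast : ℤ → ℝ))ᵀ) j i := by
  obtain ⟨Y, D, h1, h2, h3, h4, h5⟩ := exists_unimodular_frame hG c v₀
  have e1 := congrArg (fun X => X.map (Int.cast : ℤ → ℝ)) h1
  have e5 := congrArg (fun X => X.map (Int.cast : ℤ → ℝ)) h5
  simp only [Matrix.map_intCast_mul, Matrix.transpose_map] at e5
  rw [Matrix.map_zero _ Int.cast_zero] at e5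
  rw [Matrix.map_one _ Int.cast_zero Int.cast_one, Matrix.map_add _ Int.cast_add,
    Matrix.map_intCast_mul, Matrix.map_intCast_mul, Matrix.transpose_map] at e1
  have hΛ := (loopMatrix_posDef hG v₀ c ha).det_pos.ne'.isUnit
  rw [dodgson, ← Matrix.adjugate_apply, symanzik, graphMatrix_eq,
    Matrix.adjugate_fromBlocks_border e1 e5 _ hΛ]
  rfl

/-- Real circulations are real combinations of integral ones. -/
theorem exists_eq_mulVec_of_circulation (hG : G.Connected) (v₀ : V) {ι : Type*} [Fintype ι]
    [DecidableEq ι] (c : Module.Basis ι ℤ G.cycleLattice) {z : E → ℝ}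
    (hz : (G.incidence ℝ)ᵀ *ᵥ z = 0) :
    ∃ r : ι → ℝ, z = (cycleMatrix (fun l => (c l : E → ℤ))).map (Int.cast : ℤ → ℝ) *ᵥ r := by
  obtain ⟨Y, D, h1, -⟩ := exists_unimodular_frame hG c v₀
  have e1 := congrArg (fun X => X.map (Int.cast : ℤ → ℝ)) h1
  rw [Matrix.map_one _ Int.cast_zero Int.cast_one, Matrix.map_add _ Int.cast_add,
    Matrix.map_intCast_mul, Matrix.map_intCast_mul, Matrix.transpose_map] at e1
  refine ⟨Y.map Int.cast *ᵥ z, ?_⟩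
  have hε : ((G.reducedIncidence ℤ v₀).map (Int.cast : ℤ → ℝ))ᵀ *ᵥ z = 0 := by
    ext v
    rw [← incidence_map] at hz
    exact congrFun hz v
  have := congrArg (fun X => X *ᵥ z) e1
  simp only [Matrix.add_mulVec, ← Matrix.mulVec_mulVec, hε, Matrix.mulVec_zero, add_zero,
    Matrix.one_mulVec] at this
  exact this.symm

theorem Connected.completed {V E : Type*} {G : FeynGraph V E} (hG : G.Connected) (u w : V) :
    (G.completed u w).Connected :=
  fun x y => (hG x y).mono fun _ _ ⟨e, he⟩ => ⟨some e, he⟩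

/-- The loops of a completed graph: the one which closes the flow `q` through the added edge,
and the loops of the graph itself. -/
def completedCycles {E : Type*} {L : ℕ} (c : Fin L → E → ℤ) (q : E → ℤ) :
    Fin (L + 1) → Option E → ℤ :=
  Fin.cons (fun x => x.elim 1 q) fun l x => x.elim 0 (c l)

omit [Fintype V] [DecidableEq E] in
theorem completed_mulVec (G : FeynGraph V E) (u w : V) (f : Option E → ℤ) :
    ((G.completed u w).incidence ℤ)ᵀ *ᵥ f =
      f none • (Pi.single u 1 - Pi.single w 1) + (G.incidence ℤ)ᵀ *ᵥ fun e => f (some e) := by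
  ext v
  simp [Matrix.mulVec, dotProduct, Fintype.sum_option, incidence, FeynGraph.completed,
    Pi.single_apply, eq_comm, mul_comm]
  congr!

/-- Any basis of the lattice of circulations of a completed graph is related by a unimodular
matrix to the loops of the graph, together with one through the added edge. -/
theorem exists_unimodular_completedCycles (hG : G.Connected) (u w : V) {L : ℕ}
    (c : Module.Basis (Fin L) ℤ G.cycleLattice)
    (c' : Module.Basis (Fin (L + 1)) ℤ (G.completed u w).cycleLattice) {q : E → ℤ}
    (hq : (G.incidence ℤ)ᵀ *ᵥ q = Pi.single w 1 - Pi.single u 1) :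
    ∃ R A : Matrix (Fin (L + 1)) (Fin (L + 1)) ℤ, R * A = 1 ∧
      cycleMatrix (completedCycles (fun l => (c l : E → ℤ)) q) =
        cycleMatrix (fun l => (c' l : Option E → ℤ)) * R := by
  set C' := cycleMatrix (fun l => (c' l : Option E → ℤ)) with hC'
  set C := cycleMatrix (completedCycles (fun l => (c l : E → ℤ)) q) with hC
  obtain ⟨Y, D, h1, h2, h3, h4, h5⟩ := exists_unimodular_frame (hG.completed u w) c' u
  have hcirc : ((G.completed u w).reducedIncidence ℤ u)ᵀ * C = 0 := by
    have : ∀ l, ((G.completed u w).incidence ℤ)ᵀ *ᵥ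
        completedCycles (fun l => (c l : E → ℤ)) q l = 0 := by
      intro l
      rw [completed_mulVec]
      refine Fin.cases ?_ (fun l => ?_) l
      · simp [completedCycles, hq]
      · simpa [completedCycles] using (G.mem_cycleLattice _).1 (c l).2
    ext v l
    exact congrFun (this l) v
  -- Removing from a cycle its multiple of the loop through the added edge leaves a circulation of
  -- `G`. This expresses `C'` as `C A`; conversely `C = C' R` with `R = Y C`, whence `R A = Y C' =
  -- 1`.
  have hmem : ∀ l, (fun e => (c' l : Option E → ℤ) (some e) - (c' l : Option E → ℤ) none * q e)
      ∈ G.cycleLattice := by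
    intro l
    have h := ((G.completed u w).mem_cycleLattice _).1 (c' l).2
    rw [completed_mulVec] at h
    rw [mem_cycleLattice]
    have e : (fun e => (c' l : Option E → ℤ) (some e) - (c' l : Option E → ℤ) none * q e) =
        (fun e => (c' l : Option E → ℤ) (some e)) - (c' l : Option E → ℤ) none • q := rfl
    rw [e, Matrix.mulVec_sub, Matrix.mulVec_smul, hq, eq_neg_of_add_eq_zero_right h]
    module
  set A : Matrix (Fin (L + 1)) (Fin (L + 1)) ℤ := Matrix.of fun m l =>
    Fin.cases ((c' l : Option E → ℤ) none) (fun m => c.repr ⟨_, hmem l⟩ m) m with hA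
  have hCA : C' = C * A := by
    ext x l
    rw [Matrix.mul_apply, Fin.sum_univ_succ]
    cases x with
    | none => simp [hC, hC', hA, cycleMatrix, completedCycles]
    | some e =>
      have := congrArg (fun z : G.cycleLattice => (z : E → ℤ) e) (c.sum_repr ⟨_, hmem l⟩)
      simp only [Submodule.coe_sum, Submodule.coe_smul, Finset.sum_apply, Pi.smul_apply,
        smul_eq_mul] at this
      simp only [hC, hC', hA, cycleMatrix, completedCycles, Matrix.of_apply, Fin.cons_zero,
        Fin.cons_succ, Fin.cases_zero, Fin.cases_succ, Option.elim]
      simp only [mul_comm (((c _ : G.cycleLattice) : E → ℤ) e)]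
      rw [this]
      ring
  have hCR : C = C' * (Y * C) := by
    rw [← Matrix.mul_assoc, eq_sub_iff_add_eq.2 h1, Matrix.sub_mul, Matrix.mul_assoc D, hcirc]
    simp
  refine ⟨Y * C, A, ?_, hCR⟩
  rw [Matrix.mul_assoc, ← hCA, h2]

end FeynGraph

/-! ### Linear substitutions of the loop momenta -/

section LoopMap

variable {ι : Type*} [Fintype ι] [DecidableEq ι] {d : ℕ}

/-- A matrix acting on families of loop momenta. -/
noncomputable def loopMap (d : ℕ) (A : Matrix ι ι ℝ) :
    (ι → EuclideanSpace ℝ (Fin d)) →ₗ[ℝ] (ι → EuclideanSpace ℝ (Fin d)) :=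
  LinearMap.pi fun l => ∑ m, A l m • LinearMap.proj m

omit [DecidableEq ι] in
theorem loopMap_apply (A : Matrix ι ι ℝ) (k : ι → EuclideanSpace ℝ (Fin d)) (l : ι) :
    loopMap d A k l = ∑ m, A l m • k m := by
  simp [loopMap]

/-- Families of vectors as vectors of families. -/
noncomputable def componentsEquiv (ι : Type*) (d : ℕ) :
    (ι → EuclideanSpace ℝ (Fin d)) ≃ₗ[ℝ] (Fin d → ι → ℝ) where
  toFun k i l := k l i
  invFun k l := WithLp.toLp 2 fun i => k i l
  left_inv _ := rfl
  right_inv _ := rfl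
  map_add' _ _ := rfl
  map_smul' _ _ := rfl

/-- Sorted by space components, the map is a direct sum of `d` copies of `A`. -/
theorem det_loopMap (A : Matrix ι ι ℝ) : LinearMap.det (loopMap d A) = A.det ^ d := by
  rw [← LinearMap.det_conj (loopMap d A) (componentsEquiv ι d)]
  have : (componentsEquiv ι d).toLinearMap ∘ₗ loopMap d A ∘ₗ (componentsEquiv ι d).symm.toLinearMap
      = LinearMap.pi fun i => (Matrix.toLin' A).comp (LinearMap.proj i) := by
    refine LinearMap.ext fun x => funext fun i => funext fun l => ?_
    change loopMap d A (fun l => WithLp.toLp 2 fun i => x i l) l i = _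
    rw [loopMap_apply]
    simp [Matrix.mulVec, dotProduct]
  rw [this, LinearMap.det_pi]
  simp

theorem integral_comp_loopMap {A : Matrix ι ι ℝ} (hA : A.det ≠ 0)
    (g : (ι → EuclideanSpace ℝ (Fin d)) → ℝ) :
    ∫ k, g (loopMap d A k) = (|A.det| ^ d)⁻¹ * ∫ k, g k := by
  have hdet : LinearMap.det (loopMap d A) ≠ 0 := by rw [det_loopMap]; exact pow_ne_zero _ hA
  have hemb : MeasurableEmbedding (loopMap d A) :=
    (LinearMap.equivOfDetNeZero (𝕜 := ℝ) _
      hdet).toContinuousLinearEquiv.toHomeomorph.measurableEmbedding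
  rw [← hemb.integral_map, Measure.map_linearMap_addHaar_eq_smul_addHaar _ hdet,
    integral_smul_measure, det_loopMap, ENNReal.toReal_ofReal (abs_nonneg _), abs_inv, abs_pow,
    smul_eq_mul]

end LoopMap

/-! ### Gaussian moments -/

section Gaussian

variable {ι : Type*} [Fintype ι] {d : ℕ}

theorem integrable_exp_neg_mul_norm_sq {b : ℝ} (hb : 0 < b) :
    Integrable fun v : EuclideanSpace ℝ (Fin d) => Real.exp (-b * ‖v‖ ^ 2) := by
  refine Integrable.of_integral_ne_zero ?_
  rw [GaussianFourier.integral_rexp_neg_mul_sq_norm hb]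
  positivity

theorem integrable_exp_neg_mul_sum_norm_sq {b : ℝ} (hb : 0 < b) :
    Integrable fun k : ι → EuclideanSpace ℝ (Fin d) => Real.exp (-b * ∑ l, ‖k l‖ ^ 2) := by
  have : Integrable fun k : ι → EuclideanSpace ℝ (Fin d) => ∏ l, Real.exp (-b * ‖k l‖ ^ 2) :=
    Integrable.fintype_prod (f := fun (_ : ι) (v : EuclideanSpace ℝ (Fin d)) =>
      Real.exp (-b * ‖v‖ ^ 2)) fun _ => integrable_exp_neg_mul_norm_sq hb
  simpa only [← Real.exp_sum, ← Finset.mul_sum] using this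

/-- Polar coordinates turn the integrand into `r^(2b-1) exp(-r²)`. The case `b = β₀` averages the
power law in the external momentum; `b = d/2 + 1` gives the second moment. -/
theorem radial_gaussian (hd : 0 < d) {b : ℝ} (hb : 0 < b) :
    (Integrable fun v : EuclideanSpace ℝ (Fin d) =>
      Real.exp (-‖v‖ ^ 2) * (‖v‖ ^ 2) ^ (b - (d : ℝ) / 2)) ∧
    ∫ v : EuclideanSpace ℝ (Fin d), Real.exp (-‖v‖ ^ 2) * (‖v‖ ^ 2) ^ (b - (d : ℝ) / 2) =
      Real.pi ^ ((d : ℝ) / 2) * Real.Gamma b / Real.Gamma ((d : ℝ) / 2) := by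
  have : Nonempty (Fin d) := ⟨⟨0, hd⟩⟩
  set f : ℝ → ℝ := fun r => Real.exp (-r ^ 2) * (r ^ 2) ^ (b - (d : ℝ) / 2) with hf
  have heq : Set.EqOn (fun y : ℝ => y ^ (d - 1) • f y)
      (fun y : ℝ => y ^ (2 * b - 1) * Real.exp (-y ^ (2 : ℝ))) (Set.Ioi 0) := by
    intro y hy
    have hy : 0 < y := hy
    simp only [hf, smul_eq_mul]
    rw [← Real.rpow_natCast y 2, ← Real.rpow_mul hy.le, ← Real.rpow_natCast, mul_left_comm,
      ← Real.rpow_add hy, mul_comm, Nat.cast_sub hd]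
    congr 2
    push_cast
    ring
  constructor
  · refine (integrable_fun_norm_addHaar (E := EuclideanSpace ℝ (Fin d)) volume (f := f)).2 ?_
    rw [finrank_euclideanSpace, Fintype.card_fin]
    rw [integrableOn_congr_fun heq measurableSet_Ioi]
    exact integrableOn_rpow_mul_exp_neg_rpow (by linarith) two_pos
  · refine (integral_fun_norm_addHaar (E := EuclideanSpace ℝ (Fin d)) volume f).trans ?_
    rw [finrank_euclideanSpace, Fintype.card_fin, setIntegral_congr_fun measurableSet_Ioi heq,
      integral_rpow_mul_exp_neg_rpow two_pos (by linarith), Measure.real,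
      EuclideanSpace.volume_ball]
    have hG : 0 < Real.Gamma ((d : ℝ) / 2) := Real.Gamma_pos_of_pos (by positivity)
    have hd' : (d : ℝ) / 2 ≠ 0 := by positivity
    rw [Fintype.card_fin, Real.Gamma_add_one hd']
    simp only [ENNReal.ofReal_one, one_pow, one_mul, nsmul_eq_mul, smul_eq_mul]
    rw [ENNReal.toReal_ofReal (by positivity), Real.sqrt_eq_rpow, ← Real.rpow_natCast,
      ← Real.rpow_mul Real.pi_pos.le]
    field_simp
    ring_nf

theorem gaussian_norm_sq (hd : 0 < d) :
    (Integrable fun v : EuclideanSpace ℝ (Fin d) => ‖v‖ ^ 2 * Real.exp (-‖v‖ ^ 2)) ∧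
    ∫ v : EuclideanSpace ℝ (Fin d), ‖v‖ ^ 2 * Real.exp (-‖v‖ ^ 2) =
      (d / 2 : ℝ) * Real.pi ^ ((d : ℝ) / 2) := by
  have hd' : (0 : ℝ) < (d : ℝ) / 2 := by positivity
  have h := radial_gaussian hd (b := (d : ℝ) / 2 + 1) (by positivity)
  have hG := (Real.Gamma_pos_of_pos hd').ne'
  rw [Real.Gamma_add_one hd'.ne'] at h
  simp only [add_sub_cancel_left, Real.rpow_one] at h
  simp only [mul_comm (‖_‖ ^ 2)]
  refine ⟨h.1, h.2.trans ?_⟩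
  field_simp

theorem integrable_inner_mul_exp (l m : ι) :
    Integrable fun k : ι → EuclideanSpace ℝ (Fin d) =>
      inner ℝ (k l) (k m) * Real.exp (-∑ i, ‖k i‖ ^ 2) := by
  refine ((integrable_exp_neg_mul_sum_norm_sq (ι := ι) (d := d)
    (one_half_pos (α := ℝ))).const_mul 2).mono' (by fun_prop) (.of_forall fun k => ?_)
  rw [norm_mul, Real.norm_of_nonneg (Real.exp_nonneg _)]
  set Q := ∑ i, ‖k i‖ ^ 2
  have hl : ∀ l, ‖k l‖ ^ 2 ≤ Q := fun l =>
    Finset.single_le_sum (f := fun i => ‖k i‖ ^ 2) (fun i _ => by positivity) (Finset.mem_univ l)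
  have h1 : ‖(inner ℝ (k l) (k m) : ℝ)‖ ≤ Q := by
    refine (norm_inner_le_norm _ _).trans ?_
    nlinarith [hl l, hl m, sq_nonneg (‖k l‖ - ‖k m‖)]
  have h2 : Q ≤ 2 * Real.exp (Q / 2) := by linarith [Real.add_one_le_exp (Q / 2)]
  calc _ ≤ (2 * Real.exp (Q / 2)) * Real.exp (-Q) := by gcongr; exact h1.trans h2
    _ = _ := by rw [mul_assoc, ← Real.exp_add]; ring_nf

variable [DecidableEq ι]

/-- The integrand is odd under the reflection `k_l ↦ -k_l`. -/
theorem integral_inner_mul_exp_of_ne {l m : ι} (h : l ≠ m) :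
    ∫ k : ι → EuclideanSpace ℝ (Fin d), inner ℝ (k l) (k m) * Real.exp (-∑ i, ‖k i‖ ^ 2) = 0 := by
  set A : Matrix ι ι ℝ := Matrix.diagonal (Function.update 1 l (-1)) with hA
  have hdet : A.det = -1 := by
    rw [hA, Matrix.det_diagonal, Finset.prod_update_of_mem (Finset.mem_univ l)]
    simp
  have hk : ∀ (k : ι → EuclideanSpace ℝ (Fin d)) i,
      loopMap d A k i = (Function.update (1 : ι → ℝ) l (-1) i) • k i := by
    intro k i
    simp [loopMap_apply, hA, Matrix.diagonal_apply]
  have := integral_comp_loopMap (d := d) (A := A) (by rw [hdet]; norm_num)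
    (fun k => inner ℝ (k l) (k m) * Real.exp (-∑ i, ‖k i‖ ^ 2))
  simp only [hk, hdet, Function.update_self, Function.update_of_ne h.symm, Pi.one_apply, one_smul,
    neg_smul, inner_neg_left] at this
  have hn : ∀ (k : ι → EuclideanSpace ℝ (Fin d)) i,
      ‖(Function.update (1 : ι → ℝ) l (-1) i) • k i‖ = ‖k i‖ := by
    intro k i
    by_cases hi : i = l
    · subst hi; simp
    · simp [Function.update_of_ne hi]
  simp only [hn, neg_mul, integral_neg] at this
  simp at this
  linarith

theorem integral_norm_sq_mul_exp (hd : 0 < d) (l : ι) :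
    ∫ k : ι → EuclideanSpace ℝ (Fin d), inner ℝ (k l) (k l) * Real.exp (-∑ i, ‖k i‖ ^ 2) =
      (d / 2 : ℝ) * Real.pi ^ ((Fintype.card ι : ℝ) * d / 2) := by
  have := integral_fintype_prod_volume_eq_prod (ι := ι) (𝕜 := ℝ)
    (E := fun _ => EuclideanSpace ℝ (Fin d))
    (fun i v => (if i = l then ‖v‖ ^ 2 else 1) * Real.exp (-‖v‖ ^ 2))
  have hG : ∫ v : EuclideanSpace ℝ (Fin d), Real.exp (-‖v‖ ^ 2) = Real.pi ^ ((d : ℝ) / 2) := by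
    simpa using GaussianFourier.integral_rexp_neg_mul_sq_norm
      (V := EuclideanSpace ℝ (Fin d)) one_pos
  have hi : ∀ i, ∫ v : EuclideanSpace ℝ (Fin d), (if i = l then ‖v‖ ^ 2 else 1) *
      Real.exp (-‖v‖ ^ 2) = (if i = l then (d / 2 : ℝ) else 1) * Real.pi ^ ((d : ℝ) / 2) := by
    intro i
    split_ifs
    · exact (gaussian_norm_sq hd).2
    · simpa using hG
  simp only [hi, Finset.prod_mul_distrib, ← Real.exp_sum, Finset.sum_neg_distrib,
    Finset.prod_ite_eq', Finset.mem_univ, if_true, Finset.prod_const, Finset.card_univ] at this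
  simp only [real_inner_self_eq_norm_sq]
  rw [this, ← Real.rpow_natCast, ← Real.rpow_mul Real.pi_pos.le]
  ring_nf

/-- Wick's rule for one contraction: distinct momenta are uncorrelated, and each has normalized
second moment `d/2`. -/
theorem integral_inner_sum_mul_exp (hd : 0 < d) (x y : ι → ℝ) :
    ∫ k : ι → EuclideanSpace ℝ (Fin d), inner ℝ (∑ l, x l • k l) (∑ l, y l • k l) *
        Real.exp (-∑ i, ‖k i‖ ^ 2) =
      (x ⬝ᵥ y) * ((d / 2 : ℝ) * Real.pi ^ ((Fintype.card ι : ℝ) * d / 2)) := by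
  simp only [sum_inner, inner_sum, real_inner_smul_left, real_inner_smul_right, Finset.sum_mul,
    mul_assoc]
  rw [integral_finsetSum _ fun l _ => integrable_finsetSum _ fun m _ =>
    ((integrable_inner_mul_exp _ _).const_mul _).const_mul _]
  have hi : ∀ l, ∫ k : ι → EuclideanSpace ℝ (Fin d), ∑ m, y l * (x m * (inner ℝ (k m) (k l) *
      Real.exp (-∑ i, ‖k i‖ ^ 2))) =
      x l * y l * ((d / 2 : ℝ) * Real.pi ^ ((Fintype.card ι : ℝ) * d / 2)) := by
    intro l
    rw [integral_finsetSum _ fun m _ =>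
      ((integrable_inner_mul_exp _ _).const_mul _).const_mul _, Finset.sum_eq_single l]
    · rw [integral_const_mul, integral_const_mul, integral_norm_sq_mul_exp hd]
      ring
    · intro m _ hm
      rw [integral_const_mul, integral_const_mul, integral_inner_mul_exp_of_ne hm]
      simp
    · simp
  simp only [dotProduct, Finset.sum_mul, ← hi]

end Gaussian

/-! ### Schwinger's trick and Fubini -/

section FubiniAndGaussian

variable {E S : Type*} [Fintype S] {L : ℕ} {d : ℕ}

theorem continuous_edgeMomentum (c : Fin L → E → ℤ) (q : E → ℝ) (e : E) :
    Continuous fun x : EuclideanSpace ℝ (Fin d) × (Fin L → EuclideanSpace ℝ (Fin d)) =>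
      edgeMomentum d c q x.1 x.2 e := by
  unfold edgeMomentum
  fun_prop

theorem continuous_momentumNumerator (s : S → E × E) :
    Continuous fun P : E → EuclideanSpace ℝ (Fin d) => momentumNumerator d s P := by
  unfold momentumNumerator
  fun_prop

variable [Fintype E]

/-- The joint integrand, as a function of the external momentum, the loop momenta and the
Schwinger parameters. -/
theorem continuous_gaussianLoopIntegrand (c : Fin L → E → ℤ) (q : E → ℝ) (s : S → E × E) :
    Continuous fun x : (EuclideanSpace ℝ (Fin d) × (E → ℝ)) ×
        (Fin L → EuclideanSpace ℝ (Fin d)) =>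
      momentumNumerator d s (edgeMomentum d c q x.1.1 x.2) *
        Real.exp (-∑ e, x.1.2 e * ‖edgeMomentum d c q x.1.1 x.2 e‖ ^ 2) := by
  have h : ∀ e, Continuous fun x : (EuclideanSpace ℝ (Fin d) × (E → ℝ)) ×
      (Fin L → EuclideanSpace ℝ (Fin d)) => edgeMomentum d c q x.1.1 x.2 e := fun e =>
    (continuous_edgeMomentum c q e).comp (by fun_prop :
      Continuous fun x : (EuclideanSpace ℝ (Fin d) × (E → ℝ)) ×
      (Fin L → EuclideanSpace ℝ (Fin d)) => (x.1.1, x.2))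
  refine ((continuous_momentumNumerator s).comp (continuous_pi h)).mul ?_
  fun_prop

theorem measurable_gaussianLoopIntegral (c : Fin L → E → ℤ) (q : E → ℝ) (s : S → E × E) :
    Measurable fun x : EuclideanSpace ℝ (Fin d) × (E → ℝ) =>
      gaussianLoopIntegral d c q s x.1 x.2 :=
  ((continuous_gaussianLoopIntegrand c q s).stronglyMeasurable.integral_prod_right'
    (ν := volume)).measurable.const_mul _

theorem measurableSet_orthant {F : Type*} [Fintype F] :
    MeasurableSet {a : F → ℝ | ∀ e, 0 < a e} := by
  simp only [Set.ofPred_forall]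
  exact MeasurableSet.iInter fun e => measurableSet_lt measurable_const (measurable_pi_apply e)

theorem volume_restrict_orthant {F : Type*} [Fintype F] :
    (volume : Measure (F → ℝ)).restrict {a | ∀ e, 0 < a e} =
      Measure.pi fun _ => volume.restrict (Set.Ioi 0) := by
  have : {a : F → ℝ | ∀ e, 0 < a e} = Set.univ.pi fun _ => Set.Ioi 0 := by
    ext; simp
  rw [this, volume_pi, Measure.restrict_pi_pi]

/-- Schwinger's trick: the product of propagators as an integral over the orthant. -/
theorem integral_prod_rpow_mul_exp {β x : E → ℝ} (hβ : ∀ e, 0 < β e) (hx : ∀ e, 0 < x e) :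
    (IntegrableOn (fun a : E → ℝ => (∏ e, a e ^ (β e - 1)) * Real.exp (-∑ e, a e * x e))
      {a | ∀ e, 0 < a e}) ∧
    ∫ a in {a : E → ℝ | ∀ e, 0 < a e}, (∏ e, a e ^ (β e - 1)) * Real.exp (-∑ e, a e * x e) =
      (∏ e, Real.Gamma (β e)) * ∏ e, (x e ^ β e)⁻¹ := by
  have heq : (fun a : E → ℝ => (∏ e, a e ^ (β e - 1)) * Real.exp (-∑ e, a e * x e)) =
      fun a => ∏ e, a e ^ (β e - 1) * Real.exp (-(x e * a e)) := by
    funext a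
    rw [Finset.prod_mul_distrib, ← Real.exp_sum, Finset.sum_neg_distrib]
    simp only [mul_comm]
  rw [IntegrableOn, heq, volume_restrict_orthant]
  constructor
  · refine Integrable.fintype_prod (f := fun e (t : ℝ) => t ^ (β e - 1) * Real.exp (-(x e * t)))
      fun e => ?_
    have := integrableOn_rpow_mul_exp_neg_mul_rpow (p := 1) (s := β e - 1) (b := x e)
      (by linarith [hβ e]) one_pos (hx e)
    simpa [IntegrableOn] using this
  · rw [integral_fintype_prod_eq_prod (fun e (t : ℝ) => t ^ (β e - 1) * Real.exp (-(x e * t))),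
      ← Finset.prod_mul_distrib]
    refine Finset.prod_congr rfl fun e _ => ?_
    rw [Real.integral_rpow_mul_exp_neg_mul_Ioi (hβ e) (hx e), one_div,
      Real.inv_rpow (hx e).le, mul_comm]

/-- The parameter integral of the absolute value of the joint integrand is `∏ Γ(β_e)` times the
absolute value of the momentum integrand, so the hypothesis is the Tonelli condition. -/
theorem schwinger_of_momentum (c : Fin L → E → ℤ) (q : E → ℝ) {β : E → ℝ} (hβ : ∀ e, 0 < β e)
    (s : S → E × E) (p : EuclideanSpace ℝ (Fin d)) (h : MomentumConvergent d c q β s p) :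
    SchwingerConvergent d c q β s p ∧
      momentumIntegral d c q β s p = schwingerIntegral d c q β s p := by
  obtain ⟨hne, hint⟩ := h
  set μ := (volume : Measure (E → ℝ)).restrict {a | ∀ e, 0 < a e} with hμ
  set N : (Fin L → EuclideanSpace ℝ (Fin d)) → ℝ := fun k =>
    momentumNumerator d s (edgeMomentum d c q p k) with hN
  set f : (Fin L → EuclideanSpace ℝ (Fin d)) → (E → ℝ) → ℝ := fun k a =>
    N k * ((∏ e, a e ^ (β e - 1)) *
      Real.exp (-∑ e, a e * ‖edgeMomentum d c q p k e‖ ^ 2)) with hf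
  have hΓ : (∏ e, Real.Gamma (β e)) ≠ 0 :=
    Finset.prod_ne_zero_iff.2 fun e _ => (Real.Gamma_pos_of_pos (hβ e)).ne'
  have hmeas : Measurable (Function.uncurry f) := by
    have h1 : Measurable fun x : (Fin L → EuclideanSpace ℝ (Fin d)) × (E → ℝ) =>
        momentumNumerator d s (edgeMomentum d c q p x.1) *
        Real.exp (-∑ e, x.2 e * ‖edgeMomentum d c q p x.1 e‖ ^ 2) :=
      ((continuous_gaussianLoopIntegrand c q s).comp (by fun_prop : Continuous fun
        x : (Fin L → EuclideanSpace ℝ (Fin d)) × (E → ℝ) => ((p, x.2), x.1))).measurable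
    have h2 : Measurable fun x : (Fin L → EuclideanSpace ℝ (Fin d)) × (E → ℝ) =>
        ∏ e, x.2 e ^ (β e - 1) :=
      Finset.measurable_fun_prod _ fun e _ =>
        ((measurable_pi_apply e).comp measurable_snd).pow_const _
    convert h2.mul h1 using 1
    funext x
    simp only [hf, hN, Function.uncurry, Pi.mul_apply]
    ring
  -- Schwinger's formula fails where some edge momentum vanishes: there `(0 ^ β)⁻¹` is `0` by
  -- convention. Such loop momenta form a null set.
  have hprop : ∀ᵐ k : Fin L → EuclideanSpace ℝ (Fin d),
      ∀ e, 0 < ‖edgeMomentum d c q p k e‖ ^ 2 := by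
    filter_upwards [hne] with k hk e
    have := norm_pos_iff.2 (hk e)
    positivity
  have hInt : Integrable (Function.uncurry f) (volume.prod μ) := by
    rw [integrable_prod_iff hmeas.aestronglyMeasurable]
    constructor
    · filter_upwards [hprop] with k hk
      exact (integral_prod_rpow_mul_exp hβ hk).1.const_mul (N k)
    · refine (hint.norm.const_mul (∏ e, Real.Gamma (β e))).congr ?_
      filter_upwards [hprop] with k hk
      have : ∀ a ∈ {a : E → ℝ | ∀ e, 0 < a e}, ‖Function.uncurry f (k, a)‖ =
          |N k| * ((∏ e, a e ^ (β e - 1)) *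
            Real.exp (-∑ e, a e * ‖edgeMomentum d c q p k e‖ ^ 2)) := by
        intro a ha
        have : 0 ≤ ∏ e, a e ^ (β e - 1) :=
          Finset.prod_nonneg fun e _ => Real.rpow_nonneg (ha e).le _
        simp only [hf, Function.uncurry, norm_mul, Real.norm_eq_abs, Real.abs_exp,
          abs_of_nonneg this]
      rw [setIntegral_congr_fun measurableSet_orthant this, integral_const_mul,
        (integral_prod_rpow_mul_exp hβ hk).2, momentumIntegrand, norm_mul, Real.norm_eq_abs,
        Real.norm_of_nonneg (Finset.prod_nonneg fun e _ => by positivity)]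
      ring
  have hinner : ∀ a, ∫ k, f k a = (∏ e, a e ^ (β e - 1)) *
      ∫ k : Fin L → EuclideanSpace ℝ (Fin d), momentumNumerator d s (edgeMomentum d c q p k) *
      Real.exp (-∑ e, a e * ‖edgeMomentum d c q p k e‖ ^ 2) := by
    intro a
    rw [← integral_const_mul]
    congr 1
    funext k
    simp only [hf, hN]
    ring
  have hS : ∀ a, schwingerIntegrand d c q β s p a =
      (Real.pi ^ ((L : ℝ) * d / 2))⁻¹ * ∫ k, f k a := by
    intro a
    rw [hinner, schwingerIntegrand, gaussianLoopIntegral]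
    ring
  constructor
  · have := hInt.integral_prod_right.const_mul (Real.pi ^ ((L : ℝ) * d / 2))⁻¹
    rw [SchwingerConvergent, IntegrableOn, funext hS]
    exact this
  · rw [schwingerIntegral, momentumIntegral]
    simp only [hS]
    rw [integral_const_mul, ← integral_integral_swap hInt, mul_left_comm,
      ← integral_const_mul (∏ e, Real.Gamma (β e))⁻¹]
    congr 1
    refine integral_congr_ae ?_
    filter_upwards [hprop] with k hk
    simp only [hf]
    rw [integral_const_mul, (integral_prod_rpow_mul_exp hβ hk).2, momentumIntegrand,
      mul_left_comm (N k), inv_mul_cancel_left₀ hΓ]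

end FubiniAndGaussian

/-! ### Invariances and convergence of the Gaussian loop integral -/

section Symmetries

variable {E S : Type*} [Fintype S] {L : ℕ} {d : ℕ}

theorem edgeMomentum_smul (c : Fin L → E → ℤ) (q : E → ℝ) (t : ℝ) (p : EuclideanSpace ℝ (Fin d))
    (k : Fin L → EuclideanSpace ℝ (Fin d)) :
    edgeMomentum d c q (t • p) (t • k) = t • edgeMomentum d c q p k := by
  funext e
  simp [edgeMomentum, smul_add, Finset.smul_sum, smul_comm t]

theorem momentumNumerator_smul (s : S → E × E) (t : ℝ) (P : E → EuclideanSpace ℝ (Fin d)) :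
    momentumNumerator d s (t • P) = t ^ (2 * Fintype.card S) * momentumNumerator d s P := by
  simp only [momentumNumerator, Pi.smul_apply, real_inner_smul_left, real_inner_smul_right,
    ← mul_assoc, Finset.prod_mul_distrib, Finset.prod_const, Finset.card_univ]
  ring

theorem edgeMomentum_map (c : Fin L → E → ℤ) (q : E → ℝ)
    (O : EuclideanSpace ℝ (Fin d) ≃ₗᵢ[ℝ] EuclideanSpace ℝ (Fin d)) (p : EuclideanSpace ℝ (Fin d))
    (k : Fin L → EuclideanSpace ℝ (Fin d)) (e : E) :
    edgeMomentum d c q (O p) (fun l => O (k l)) e = O (edgeMomentum d c q p k e) := by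
  simp [edgeMomentum, map_sum]

theorem edgeMomentum_loopMap (c c' : Fin L → E → ℤ) (R : Matrix (Fin L) (Fin L) ℤ)
    (h : FeynGraph.cycleMatrix c' = FeynGraph.cycleMatrix c * R)
    (k : Fin L → EuclideanSpace ℝ (Fin d)) :
    edgeMomentum d c 0 0 (loopMap d (R.map (Int.cast : ℤ → ℝ)) k) =
      edgeMomentum d c' 0 0 k := by
  funext e
  have : ∀ m, c' m e = ∑ l, c l e * R l m := fun m => congrFun (congrFun h e) m
  simp only [edgeMomentum, loopMap_apply, this, Finset.smul_sum, smul_smul, Int.cast_sum,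
    Int.cast_mul, Finset.sum_smul, Matrix.map_apply]
  rw [Finset.sum_comm]

theorem edgeMomentum_completedCycles (c : Fin L → E → ℤ) (q : E → ℤ)
    (k : Fin (L + 1) → EuclideanSpace ℝ (Fin d)) (x : Option E) :
    edgeMomentum d (FeynGraph.completedCycles c q) 0 0 k x =
      x.elim (k 0) (edgeMomentum d c (fun e => (q e : ℝ)) (k 0) fun l => k l.succ) := by
  cases x <;>
    simp [edgeMomentum, FeynGraph.completedCycles, Fin.sum_univ_succ, add_comm]

variable [Fintype E]

/-- Substitute `k ↦ t k`: the Jacobian gives `t^(L d)`, each scalar product gives `t²`, and the `t²`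
in the exponent is absorbed by the parameters. -/
theorem gaussianLoopIntegral_smul (c : Fin L → E → ℤ) (q : E → ℝ) (s : S → E × E) {t : ℝ}
    (ht : 0 < t) (p : EuclideanSpace ℝ (Fin d)) (a : E → ℝ) :
    gaussianLoopIntegral d c q s (t • p) a =
      t ^ (L * d + 2 * Fintype.card S) * gaussianLoopIntegral d c q s p (t ^ 2 • a) := by
  have h := Measure.integral_comp_smul (volume : Measure (Fin L → EuclideanSpace ℝ (Fin d)))
    (fun k => momentumNumerator d s (edgeMomentum d c q (t • p) k) *
      Real.exp (-∑ e, a e * ‖edgeMomentum d c q (t • p) k e‖ ^ 2)) t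
  have hfin : Module.finrank ℝ (Fin L → EuclideanSpace ℝ (Fin d)) = L * d := by
    simp [Module.finrank_pi_fintype]
  simp only [edgeMomentum_smul, momentumNumerator_smul, hfin, Pi.smul_apply, norm_smul, mul_pow,
    Real.norm_of_nonneg ht.le, smul_eq_mul, mul_assoc] at h
  rw [integral_const_mul, abs_of_pos (by positivity)] at h
  simp only [gaussianLoopIntegral, Pi.smul_apply, smul_eq_mul]
  have h2 : ∀ (k : Fin L → EuclideanSpace ℝ (Fin d)),
      ∑ e, a e * (t ^ 2 * ‖edgeMomentum d c q p k e‖ ^ 2) =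
    ∑ e, t ^ 2 * a e * ‖edgeMomentum d c q p k e‖ ^ 2 := fun k =>
      Finset.sum_congr rfl fun e _ => by ring
  simp only [h2] at h
  rw [eq_inv_mul_iff_mul_eq₀ (by positivity)] at h
  rw [← h, pow_add]
  ring

theorem gaussianLoopIntegral_map (c : Fin L → E → ℤ) (q : E → ℝ) (s : S → E × E)
    (O : EuclideanSpace ℝ (Fin d) ≃ₗᵢ[ℝ] EuclideanSpace ℝ (Fin d)) (p : EuclideanSpace ℝ (Fin d))
    (a : E → ℝ) :
    gaussianLoopIntegral d c q s (O p) a = gaussianLoopIntegral d c q s p a := by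
  have hO : MeasurePreserving (fun (k : Fin L → EuclideanSpace ℝ (Fin d)) l => O (k l)) :=
    volume_preserving_pi fun _ => O.measurePreserving
  have hemb : MeasurableEmbedding (fun (k : Fin L → EuclideanSpace ℝ (Fin d)) l => O (k l)) :=
    (MeasurableEquiv.piCongrRight fun _ : Fin L => O.toMeasurableEquiv).measurableEmbedding
  rw [gaussianLoopIntegral, gaussianLoopIntegral, ← hO.integral_comp hemb]
  simp only [edgeMomentum_map, LinearIsometryEquiv.norm_map, momentumNumerator,
    LinearIsometryEquiv.inner_map_map]

/-- A change of routing by a circulation is undone by the translation `k_l ↦ k_l + r_l p`. -/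
theorem gaussianLoopIntegral_reroute (c : Fin L → E → ℤ) {q q' : E → ℝ} (r : Fin L → ℝ)
    (h : ∀ e, q e = q' e + ∑ l, c l e * r l) (s : S → E × E) (p : EuclideanSpace ℝ (Fin d)) :
    gaussianLoopIntegral d c q s p = gaussianLoopIntegral d c q' s p := by
  have he : ∀ k : Fin L → EuclideanSpace ℝ (Fin d), edgeMomentum d c q p k =
      edgeMomentum d c q' p (k + fun l => r l • p) := by
    intro k
    funext e
    simp only [edgeMomentum, h, Pi.add_apply, smul_add, Finset.sum_add_distrib, smul_smul,
      add_smul, Finset.sum_smul]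
    abel
  funext a
  simp only [gaussianLoopIntegral, he]
  rw [integral_add_right_eq_self fun k => momentumNumerator d s (edgeMomentum d c q' p k) *
    Real.exp (-∑ e, a e * ‖edgeMomentum d c q' p k e‖ ^ 2)]

theorem gaussianLoopIntegral_basis_change (c c' : Fin L → E → ℤ) (R A : Matrix (Fin L) (Fin L) ℤ)
    (h : FeynGraph.cycleMatrix c' = FeynGraph.cycleMatrix c * R) (hRA : R * A = 1) (s : S → E × E)
    (a : E → ℝ) :
    gaussianLoopIntegral d c' 0 s 0 a = gaussianLoopIntegral d c 0 s 0 a := by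
  have hdet : |(R.map (Int.cast : ℤ → ℝ)).det| = 1 := by
    have hu : IsUnit R.det := IsUnit.of_mul_eq_one A.det (by
      rw [← Matrix.det_mul, hRA, Matrix.det_one])
    have hcast : (R.map (Int.cast : ℤ → ℝ)).det = (R.det : ℝ) :=
      ((Int.castRingHom ℝ).map_det R).symm
    rw [hcast]
    rcases Int.isUnit_iff.1 hu with h1 | h1 <;> rw [h1] <;> simp
  have hne : (R.map (Int.cast : ℤ → ℝ)).det ≠ 0 := by
    intro h0
    rw [h0] at hdet
    simp at hdet
  have := integral_comp_loopMap (d := d) hne fun k =>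
    momentumNumerator d s (edgeMomentum d c 0 0 k) *
      Real.exp (-∑ e, a e * ‖edgeMomentum d c 0 0 k e‖ ^ 2)
  simp only [edgeMomentum_loopMap c c' R h, hdet, one_pow, inv_one, one_mul] at this
  rw [gaussianLoopIntegral, this, gaussianLoopIntegral]

theorem abs_momentumNumerator_le (s : S → E × E) (P : E → EuclideanSpace ℝ (Fin d)) :
    |momentumNumerator d s P| ≤ (1 + ∑ e, ‖P e‖ ^ 2) ^ Fintype.card S := by
  rw [momentumNumerator, Finset.abs_prod, ← Finset.card_univ, ← Finset.prod_const]
  refine Finset.prod_le_prod (fun _ _ => abs_nonneg _) fun x _ => ?_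
  have hl : ∀ e, ‖P e‖ ^ 2 ≤ ∑ e, ‖P e‖ ^ 2 := fun e =>
    Finset.single_le_sum (f := fun e => ‖P e‖ ^ 2) (fun i _ => by positivity) (Finset.mem_univ e)
  refine (abs_real_inner_le_norm _ _).trans ?_
  nlinarith [hl (s x).1, hl (s x).2, sq_nonneg (‖P (s x).1‖ - ‖P (s x).2‖)]

/-- A polynomial is dominated by an exponential, uniformly on the half line. -/
theorem exists_pow_le_mul_exp (n : ℕ) {η : ℝ} (hη : 0 < η) :
    ∃ M, ∀ Q : ℝ, 0 ≤ Q → (1 + Q) ^ n ≤ M * Real.exp (η * Q) := by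
  refine ⟨n.factorial / η ^ n * Real.exp η, fun Q hQ => ?_⟩
  have h := Real.pow_div_factorial_le_exp (η * (1 + Q)) (by positivity) n
  have h1 : Real.exp (η * (1 + Q)) = Real.exp η * Real.exp (η * Q) := by
    rw [← Real.exp_add]; ring_nf
  rw [h1, div_le_iff₀ (by positivity), mul_pow] at h
  have h2 : 0 < η ^ n := by positivity
  calc (1 + Q) ^ n = (η ^ n * (1 + Q) ^ n) / η ^ n := by field_simp
    _ ≤ (Real.exp η * Real.exp (η * Q) * n.factorial) / η ^ n := by gcongr
    _ = _ := by ring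

/-- The loop momenta are controlled by the edge momenta. -/
theorem exists_sum_norm_sq_le [DecidableEq E] (c : Fin L → E → ℤ) {Y : Matrix (Fin L) E ℝ}
    (hY : Y * (FeynGraph.cycleMatrix c).map (Int.cast : ℤ → ℝ) = 1) :
    ∃ K, 0 < K ∧ ∀ k : Fin L → EuclideanSpace ℝ (Fin d),
      ∑ l, ‖k l‖ ^ 2 ≤ K * ∑ e, ‖edgeMomentum d c 0 0 k e‖ ^ 2 := by
  -- Cauchy–Schwarz applied to `k = Y P` gives the double sum, `P` being the edge momenta; the `1`
  -- only ensures positivity.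
  refine ⟨1 + ∑ l, ∑ e, ‖Y l e‖ ^ 2, by positivity, fun k => ?_⟩
  set Q := ∑ e, ‖edgeMomentum d c 0 0 k e‖ ^ 2 with hQ
  have hQ0 : 0 ≤ Q := by positivity
  have hk : ∀ l, k l = ∑ e, Y l e • edgeMomentum d c 0 0 k e := by
    intro l
    have : ∀ m, ∑ e, Y l e * (c m e : ℝ) = (1 : Matrix (Fin L) (Fin L) ℝ) l m := fun m =>
      congrFun (congrFun hY l) m
    simp only [edgeMomentum, Pi.zero_apply, zero_smul, add_zero, Finset.smul_sum, smul_smul]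
    rw [Finset.sum_comm]
    simp only [← Finset.sum_smul, this, Matrix.one_apply, ite_smul, one_smul, zero_smul]
    simp
  have hl : ∀ l, ‖k l‖ ^ 2 ≤ (∑ e, ‖Y l e‖ ^ 2) * Q := by
    intro l
    have h1 : ‖k l‖ ≤ ∑ e, ‖Y l e‖ * ‖edgeMomentum d c 0 0 k e‖ := by
      conv_lhs => rw [hk l]
      exact (norm_sum_le _ _).trans_eq (by simp only [norm_smul])
    calc ‖k l‖ ^ 2 ≤ (∑ e, ‖Y l e‖ * ‖edgeMomentum d c 0 0 k e‖) ^ 2 := by gcongr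
      _ ≤ _ := Finset.sum_mul_sq_le_sq_mul_sq _ _ _
  calc ∑ l, ‖k l‖ ^ 2 ≤ ∑ l, (∑ e, ‖Y l e‖ ^ 2) * Q := Finset.sum_le_sum fun l _ => hl l
    _ = (∑ l, ∑ e, ‖Y l e‖ ^ 2) * Q := by rw [Finset.sum_mul]
    _ ≤ _ := by gcongr; linarith

/-- Half of the exponential decay in the edge momenta absorbs the polynomial numerator; the other
half is Gaussian decay in the loop momenta, thanks to the left inverse `Y`. -/
theorem integrable_gaussianLoopIntegrand [DecidableEq E] (c : Fin L → E → ℤ)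
    {Y : Matrix (Fin L) E ℝ} (hY : Y * (FeynGraph.cycleMatrix c).map (Int.cast : ℤ → ℝ) = 1)
    (s : S → E × E) {a : E → ℝ} (ha : ∀ e, 0 < a e) :
    Integrable fun k : Fin L → EuclideanSpace ℝ (Fin d) =>
      momentumNumerator d s (edgeMomentum d c 0 0 k) *
        Real.exp (-∑ e, a e * ‖edgeMomentum d c 0 0 k e‖ ^ 2) := by
  obtain ⟨α, hα, hαa⟩ : ∃ α : ℝ, 0 < α ∧ ∀ e, α ≤ a e := by
    rcases isEmpty_or_nonempty E with hE | hE
    · exact ⟨1, one_pos, fun e => hE.elim e⟩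
    · obtain ⟨e₀, he₀⟩ := Finite.exists_min a
      exact ⟨a e₀, ha e₀, he₀⟩
  obtain ⟨M, hM⟩ := exists_pow_le_mul_exp (Fintype.card S) (half_pos hα)
  obtain ⟨K, hK, hKk⟩ := exists_sum_norm_sq_le (d := d) c hY
  have hM0 : 0 ≤ M := by
    have := hM 0 le_rfl
    simp at this
    linarith
  refine ((integrable_exp_neg_mul_sum_norm_sq (ι := Fin L) (d := d)
    (b := α / 2 / K) (by positivity)).const_mul M).mono' ?_ (.of_forall fun k => ?_)
  · exact ((continuous_gaussianLoopIntegrand c 0 s).comp (by fun_prop :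
      Continuous fun k : Fin L → EuclideanSpace ℝ (Fin d) =>
        (((0 : EuclideanSpace ℝ (Fin d)), a), k))).aestronglyMeasurable
  · rw [norm_mul, Real.norm_of_nonneg (Real.exp_nonneg _), Real.norm_eq_abs]
    have hk := hKk k
    set Q := ∑ e, ‖edgeMomentum d c 0 0 k e‖ ^ 2 with hQ
    have hQ0 : 0 ≤ Q := by positivity
    have h1 : α * Q ≤ ∑ e, a e * ‖edgeMomentum d c 0 0 k e‖ ^ 2 := by
      rw [hQ, Finset.mul_sum]
      exact Finset.sum_le_sum fun e _ => by gcongr; exact hαa e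
    have h2 : α / 2 / K * ∑ l, ‖k l‖ ^ 2 ≤ α / 2 * Q := by
      rw [div_mul_eq_mul_div, div_le_iff₀ hK]
      nlinarith
    calc _ ≤ (M * Real.exp (α / 2 * Q)) * Real.exp (-(α * Q)) := by
          gcongr
          exact (abs_momentumNumerator_le s _).trans (hM Q hQ0)
      _ = M * Real.exp (-(α / 2 * Q)) := by rw [mul_assoc, ← Real.exp_add]; ring_nf
      _ ≤ _ := by
        gcongr
        linarith

/-- The vacuum integral of the completed graph, as an integral over the external momentum. -/
theorem gaussianLoopIntegral_completedCycles [DecidableEq E] (c : Fin L → E → ℤ) (q : E → ℤ)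
    {Y : Matrix (Fin (L + 1)) (Option E) ℝ}
    (hY : Y * (FeynGraph.cycleMatrix (FeynGraph.completedCycles c q)).map (Int.cast : ℤ → ℝ) = 1)
    (s : S → E × E) {a : Option E → ℝ} (ha : ∀ x, 0 < a x) :
    gaussianLoopIntegral d (FeynGraph.completedCycles c q) 0
        (fun t => (some (s t).1, some (s t).2)) 0 a =
      (Real.pi ^ ((d : ℝ) / 2))⁻¹ * ∫ p : EuclideanSpace ℝ (Fin d),
        Real.exp (-(a none * ‖p‖ ^ 2)) *
          gaussianLoopIntegral d c (fun e => (q e : ℝ)) s p fun e => a (some e) := by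
  have hint := integrable_gaussianLoopIntegrand (d := d) _ hY
    (fun t => (some (s t).1, some (s t).2)) ha
  -- Loop momentum `0` belongs to the cycle through the added edge, so splitting it off exhibits it
  -- as the external momentum of `G`.
  have hmp := (volume_preserving_piFinSuccAbove
    (fun _ : Fin (L + 1) => EuclideanSpace ℝ (Fin d)) 0).symm
  rw [gaussianLoopIntegral, ← hmp.integral_comp (MeasurableEquiv.measurableEmbedding _)]
  rw [← hmp.integrable_comp_emb (MeasurableEquiv.measurableEmbedding _)] at hint
  rw [Measure.volume_eq_prod] at hint ⊢
  simp only [Function.comp_def] at hint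
  rw [integral_prod _ hint]
  have hexp : Real.pi ^ (((L + 1 : ℕ) : ℝ) * d / 2) =
      Real.pi ^ ((L : ℝ) * d / 2) * Real.pi ^ ((d : ℝ) / 2) := by
    rw [← Real.rpow_add Real.pi_pos]
    push_cast
    ring_nf
  rw [hexp, mul_inv, mul_comm (Real.pi ^ _)⁻¹, mul_assoc, ← integral_const_mul]
  congr 2
  funext p
  simp only [gaussianLoopIntegral]
  rw [mul_left_comm]
  congr 1
  rw [← integral_const_mul]
  congr 1
  funext k
  simp only [MeasurableEquiv.piFinSuccAbove_symm_apply, momentumNumerator,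
    edgeMomentum_completedCycles, Fintype.sum_option, Option.elim, Fin.insertNthEquiv_zero,
    Fin.consEquiv_apply, Fin.cons_zero, Fin.cons_succ]
  rw [neg_add, Real.exp_add]
  ring

end Symmetries

/-! ### Independence of the hyperplane (Cheng–Wu) -/

section ChengWu

open scoped ENNReal

variable {F : Type*} [Fintype F] [DecidableEq F]

/-- The point whose coordinates off `x₀` are `b`, and whose coordinates in `T ∋ x₀` add up
to `y`. -/
def sumPoint (T : Finset F) (x₀ : F) (y : ℝ) (b : {x : F // x ≠ x₀} → ℝ) : F → ℝ :=
  fun x => if h : x = x₀ then y - ∑ z : {x : F // x ≠ x₀}, (if z.1 ∈ T then b z else 0)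
    else b ⟨x, h⟩

theorem sumPoint_smul (T : Finset F) (x₀ : F) (y : ℝ) (b : {x : F // x ≠ x₀} → ℝ) :
    sumPoint T x₀ y (y • b) = y • slicePoint T x₀ b := by
  funext x
  by_cases h : x = x₀
  · simp [sumPoint, slicePoint, h, mul_sub, Finset.mul_sum]
  · simp [sumPoint, slicePoint, h]

theorem sum_sumPoint {T : Finset F} {x₀ : F} (hx₀ : x₀ ∈ T) (y : ℝ) (b : {x : F // x ≠ x₀} → ℝ) :
    ∑ x ∈ T, sumPoint T x₀ y b x = y := by
  have h1 : ∑ z : {x : F // x ≠ x₀}, (if z.1 ∈ T then b z else 0) =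
      ∑ x ∈ T.erase x₀, sumPoint T x₀ y b x := by
    have h2 : ∀ z : {x : F // x ≠ x₀}, (if z.1 ∈ T then b z else 0) =
        if z.1 ∈ T then sumPoint T x₀ y b z.1 else 0 := by
      intro z
      simp [sumPoint, z.2]
    rw [Finset.sum_congr rfl fun z _ => h2 z,
      ← Finset.sum_subtype (Finset.univ.erase x₀) (by simp)
        (fun x => if x ∈ T then sumPoint T x₀ y b x else 0), ← Finset.sum_filter]
    congr 1
    ext x
    simp
  rw [← Finset.add_sum_erase T _ hx₀, ← h1]
  simp [sumPoint]

theorem measurable_sumPoint (T : Finset F) (x₀ : F) :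
    Measurable fun z : ℝ × ({x : F // x ≠ x₀} → ℝ) => sumPoint T x₀ z.1 z.2 := by
  refine measurable_pi_lambda _ fun x => ?_
  by_cases h : x = x₀
  · simp only [sumPoint, h, dite_true]
    refine measurable_fst.sub (Finset.measurable_fun_sum _ fun z _ => ?_)
    by_cases hz : z.1 ∈ T
    · simp only [hz, if_true]
      exact (measurable_pi_apply z).comp measurable_snd
    · simp only [hz, if_false]
      exact measurable_const
  · simp only [sumPoint, h, dite_false]
    exact (measurable_pi_apply _).comp measurable_snd

/-- Integration in the coordinates `(y, b) ↦ sumPoint T x₀ y b`. -/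
theorem lintegral_eq_lintegral_sumPoint (T : Finset F) (x₀ : F) {f : (F → ℝ) → ℝ≥0∞}
    (hf : Measurable f) :
    ∫⁻ a, f a = ∫⁻ y : ℝ, ∫⁻ b : {x : F // x ≠ x₀} → ℝ, f (sumPoint T x₀ y b) := by
  have hmp := (volume_preserving_piEquivPiSubtypeProd (fun _ : F => ℝ) (fun x => x = x₀)).symm
  have hu := (volume_preserving_funUnique {x : F // x = x₀} ℝ).symm
  rw [lintegral_lintegral_swap]
  swap
  · exact (hf.comp (measurable_sumPoint T x₀)).aemeasurable
  rw [← hmp.lintegral_comp_emb (MeasurableEquiv.measurableEmbedding _), Measure.volume_eq_prod,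
    lintegral_prod_symm]
  swap
  · exact (hf.comp (MeasurableEquiv.measurable _)).aemeasurable
  refine lintegral_congr fun b => ?_
  trans ∫⁻ y, f ((MeasurableEquiv.piEquivPiSubtypeProd (fun _ : F => ℝ) fun x => x = x₀).symm
    ((MeasurableEquiv.funUnique {x : F // x = x₀} ℝ).symm y, b))
  · convert (hu.lintegral_comp_emb (MeasurableEquiv.measurableEmbedding _) (fun z => f
      ((MeasurableEquiv.piEquivPiSubtypeProd (fun _ : F => ℝ) fun x => x = x₀).symm (z, b)))).symm
  -- For fixed `b`, passing from `a_{x₀}` to the level `y` is a translation.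
  rw [← lintegral_sub_right_eq_self _ (∑ z : {x : F // x ≠ x₀}, (if z.1 ∈ T then b z else 0))]
  exact lintegral_congr fun y => by congr 1

theorem lintegral_comp_smul_pi {X : Type*} [Fintype X] {f : (X → ℝ) → ℝ≥0∞} (hf : Measurable f)
    {r : ℝ} (hr : 0 < r) :
    ∫⁻ b, f b = ENNReal.ofReal r ^ Fintype.card X * ∫⁻ b, f (r • b) := by
  rw [← lintegral_map hf (measurable_const_smul r), Measure.map_addHaar_smul _ hr.ne',
    lintegral_smul_measure, Module.finrank_pi, abs_of_pos (by positivity), smul_eq_mul,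
    ← mul_assoc, ← ENNReal.ofReal_pow hr.le, ← ENNReal.ofReal_mul (by positivity),
    mul_inv_cancel₀ (by positivity), ENNReal.ofReal_one, one_mul]

/-- Normalization of the weight `(∑ a) exp(-∑ a)` along a ray, `h` being the sum of all coordinates
at the slice point. -/
theorem lintegral_mul_exp_neg {h : ℝ} (hh : 0 < h) :
    ∫⁻ y in Set.Ioi (0 : ℝ), ENNReal.ofReal (h * Real.exp (-(y * h))) = 1 := by
  have hi : IntegrableOn (fun y => h * Real.exp (-h * y)) (Set.Ioi 0) :=
    (integrableOn_exp_mul_Ioi (by linarith) 0).const_mul h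
  have : ∀ y, h * Real.exp (-(y * h)) = h * Real.exp (-h * y) := fun y => by ring_nf
  simp only [this]
  rw [← ofReal_integral_eq_lintegral_ofReal hi (.of_forall fun y => by positivity),
    integral_const_mul, integral_exp_mul_Ioi (by linarith)]
  simp [hh.ne']

/-- The projective integral of a homogeneous function over a hyperplane does not depend on the
hyperplane: it is an integral over the orthant with a weight independent of it. -/
theorem lintegral_positiveSlice {T : Finset F} {x₀ : F} (hx₀ : x₀ ∈ T) {g : (F → ℝ) → ℝ≥0∞}
    (hg : Measurable g)
    (hom : ∀ t : ℝ, 0 < t → ∀ a : F → ℝ, (∀ x, 0 < a x) →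
      ENNReal.ofReal t ^ Fintype.card F * g (t • a) = g a) :
    ∫⁻ b in positiveSlice T x₀, g (slicePoint T x₀ b) =
      ∫⁻ a in {a : F → ℝ | ∀ x, 0 < a x},
        g a * ENNReal.ofReal ((∑ x, a x) * Real.exp (-∑ x, a x)) := by
  set O : Set (F → ℝ) := {a | ∀ x, 0 < a x} with hO
  set φ : (F → ℝ) → ℝ≥0∞ := fun a => ENNReal.ofReal ((∑ x, a x) * Real.exp (-∑ x, a x))
  have hφm : Measurable φ := by
    fun_prop
  have hOm : MeasurableSet O := measurableSet_orthant
  have hsp : Measurable (slicePoint T x₀) :=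
    (measurable_sumPoint T x₀).comp (measurable_const (a := (1 : ℝ)).prodMk measurable_id)
  have hsl : MeasurableSet (positiveSlice T x₀) := hsp hOm
  have hfm : Measurable (O.indicator fun a => g a * φ a) := (hg.mul hφm).indicator hOm
  rw [← lintegral_indicator hOm, lintegral_eq_lintegral_sumPoint T x₀ hfm]
  have hcard : Fintype.card F = Fintype.card {x : F // x ≠ x₀} + 1 := by
    rw [Fintype.card_subtype_compl, Fintype.card_subtype_eq]
    have := Fintype.card_pos_iff.2 ⟨x₀⟩
    omega
  -- Level `y` is `y` times the slice. The rescaling of `b` contributes one factor `y` for each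
  -- coordinate other than `x₀`, the prefactor `∑ a` of the weight contributes the last one, and
  -- homogeneity of `g` consumes them all.
  have hy : ∀ y : ℝ, ∫⁻ b : {x : F // x ≠ x₀} → ℝ,
      (O.indicator fun a => g a * φ a) (sumPoint T x₀ y b) =
      (Set.Ioi (0 : ℝ)).indicator (fun y => ∫⁻ b, (positiveSlice T x₀).indicator (fun b =>
        g (slicePoint T x₀ b) * ENNReal.ofReal ((∑ x, slicePoint T x₀ b x) *
          Real.exp (-(y * ∑ x, slicePoint T x₀ b x)))) b) y := by
    intro y
    by_cases hy : 0 < y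
    · rw [Set.indicator_of_mem (Set.mem_Ioi.2 hy), lintegral_comp_smul_pi (f := fun b =>
        (O.indicator fun a => g a * φ a) (sumPoint T x₀ y b)) (hfm.comp
        ((measurable_sumPoint T x₀).comp measurable_prodMk_left)) hy, ← lintegral_const_mul' _ _
          (ENNReal.pow_ne_top ENNReal.ofReal_ne_top)]
      refine lintegral_congr fun b => ?_
      simp only [sumPoint_smul]
      by_cases hb : b ∈ positiveSlice T x₀
      · have hb' : slicePoint T x₀ b ∈ O := hb
        have hb'' : y • slicePoint T x₀ b ∈ O := fun x => mul_pos hy (hb x)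
        rw [Set.indicator_of_mem hb'', Set.indicator_of_mem hb, ← hom y hy _ hb', hcard, pow_succ]
        simp only [φ, Pi.smul_apply, smul_eq_mul, ← Finset.mul_sum]
        rw [mul_assoc y, ENNReal.ofReal_mul hy.le]
        ring
      · have hb'' : y • slicePoint T x₀ b ∉ O := by
          intro h
          refine hb fun x => ?_
          exact pos_of_mul_pos_right (h x) hy.le
        rw [Set.indicator_of_notMem hb'', Set.indicator_of_notMem hb, mul_zero]
    -- Levels `y ≤ 0` miss the orthant, because `T` contains `x₀` and a sum of positive coordinates
    -- is positive.
    · rw [Set.indicator_of_notMem (fun h => hy (Set.mem_Ioi.1 h))]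
      rw [lintegral_congr (g := fun _ => 0), lintegral_zero]
      intro b
      refine Set.indicator_of_notMem (fun h => hy ?_) _
      rw [← sum_sumPoint hx₀ y b]
      exact Finset.sum_pos (fun x _ => h x) ⟨x₀, hx₀⟩
  rw [lintegral_congr hy, lintegral_indicator measurableSet_Ioi, lintegral_lintegral_swap,
    ← lintegral_indicator hsl]
  · refine lintegral_congr fun b => ?_
    by_cases hb : b ∈ positiveSlice T x₀
    · simp only [Set.indicator_of_mem hb]
      rw [lintegral_const_mul _ (by fun_prop), lintegral_mul_exp_neg, mul_one]
      exact Finset.sum_pos (fun x _ => hb x) ⟨x₀, Finset.mem_univ _⟩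
    · simp [Set.indicator_of_notMem hb]
  · refine Measurable.aemeasurable ?_
    have : Measurable fun z : ℝ × ({x : F // x ≠ x₀} → ℝ) => slicePoint T x₀ z.2 :=
      hsp.comp measurable_snd
    refine Measurable.indicator (s := {z : ℝ × ({x : F // x ≠ x₀} → ℝ) | z.2 ∈ positiveSlice T x₀})
      (f := fun z => g (slicePoint T x₀ z.2) * ENNReal.ofReal ((∑ x, slicePoint T x₀ z.2 x) *
          Real.exp (-(z.1 * ∑ x, slicePoint T x₀ z.2 x)))) ?_ (measurable_snd hsl)
    have h2 : Measurable fun z : ℝ × ({x : F // x ≠ x₀} → ℝ) => ∑ x, slicePoint T x₀ z.2 x :=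
      Finset.measurable_fun_sum _ fun x _ => (measurable_pi_apply x).comp this
    exact (hg.comp this).mul (h2.mul (measurable_fst.mul h2).neg.exp).ennreal_ofReal

/-- The projective integral of a homogeneous function does not depend on the hyperplane. -/
theorem deltaIntegral_independent {T T' : Finset F} {x₀ x₀' : F} (hx₀ : x₀ ∈ T) (hx₀' : x₀' ∈ T')
    {f : (F → ℝ) → ℝ} (hf : Measurable f)
    (hom : ∀ t : ℝ, 0 < t → ∀ a : F → ℝ, (∀ x, 0 < a x) → t ^ Fintype.card F * f (t • a) = f a)
    (h : DeltaIntegrable T x₀ f) :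
    DeltaIntegrable T' x₀' f ∧ deltaIntegral T' x₀' f = deltaIntegral T x₀ f := by
  have hsp : ∀ (T : Finset F) (x₀ : F), Measurable (slicePoint T x₀) := fun T x₀ =>
    (measurable_sumPoint T x₀).comp (measurable_const (a := (1 : ℝ)).prodMk measurable_id)
  -- Used for the norm (integrability) and for the positive and negative parts (value): all three
  -- are positively homogeneous of degree one, so they preserve the homogeneity of `f`.
  have key : ∀ g : ℝ → ℝ≥0∞, Measurable g →
      (∀ t r : ℝ, 0 < t → g (t * r) = ENNReal.ofReal t * g r) →
      ∫⁻ b in positiveSlice T' x₀', g (f (slicePoint T' x₀' b)) =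
        ∫⁻ b in positiveSlice T x₀, g (f (slicePoint T x₀ b)) := by
    intro g hg hgt
    have h' : ∀ t : ℝ, 0 < t → ∀ a : F → ℝ, (∀ x, 0 < a x) →
      ENNReal.ofReal t ^ Fintype.card F * g (f (t • a)) = g (f a) := by
      intro t ht a ha
      rw [← hom t ht a ha, hgt _ _ (by positivity), ENNReal.ofReal_pow ht.le]
    exact (lintegral_positiveSlice hx₀' (hg.comp hf) h').trans
      (lintegral_positiveSlice hx₀ (hg.comp hf) h').symm
  have hint : DeltaIntegrable T' x₀' f := by
    refine ⟨(hf.comp (hsp T' x₀')).aestronglyMeasurable, ?_⟩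
    have h2 := h.2
    rw [HasFiniteIntegral] at h2 ⊢
    rwa [key (fun r => ‖r‖ₑ) measurable_enorm]
    intro t r ht
    rw [enorm_mul, Real.enorm_of_nonneg ht.le]
  refine ⟨hint, ?_⟩
  rw [deltaIntegral, deltaIntegral, integral_eq_lintegral_pos_part_sub_lintegral_neg_part hint,
    integral_eq_lintegral_pos_part_sub_lintegral_neg_part h, key ENNReal.ofReal (by fun_prop),
    key (fun r => ENNReal.ofReal (-r)) (by fun_prop)]
  · intro t r ht
    rw [← mul_neg, ENNReal.ofReal_mul ht.le]
  · intro t r ht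
    rw [ENNReal.ofReal_mul ht.le]

end ChengWu

open scoped MatrixOrder in
theorem Matrix.PosSemidef.exists_eq_transpose_mul_self {n : Type*} [Fintype n] [DecidableEq n]
    {A : Matrix n n ℝ} (hA : A.PosSemidef) : ∃ P : Matrix n n ℝ, A = Pᵀ * P := by
  have h1 := CFC.sqrt_mul_sqrt_self A hA.nonneg
  have h2 := (Matrix.nonneg_iff_posSemidef.1 (CFC.sqrt_nonneg A)).1
  rw [Matrix.IsHermitian, Matrix.conjTranspose_eq_transpose_of_trivial] at h2
  exact ⟨CFC.sqrt A, by rw [h2, h1]⟩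

/-! ### The vacuum integrand with a single scalar product -/

section ScalarProduct

open FeynGraph

variable {E S : Type*} [Fintype E] [DecidableEq E] {L : ℕ} {d : ℕ}

omit [Fintype E] [DecidableEq E] in
theorem edgeMomentum_loopMap_real (c : Fin L → E → ℤ) (A : Matrix (Fin L) (Fin L) ℝ)
    (k : Fin L → EuclideanSpace ℝ (Fin d)) (e : E) :
    edgeMomentum d c 0 0 (loopMap d A k) e =
      ∑ l, ((cycleMatrix c).map (Int.cast : ℤ → ℝ) * A) e l • k l := by
  simp only [edgeMomentum, loopMap_apply, Finset.smul_sum, smul_smul, Pi.zero_apply, zero_smul,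
    add_zero, Matrix.mul_apply, Finset.sum_smul]
  rw [Finset.sum_comm]
  rfl

/-- A family of forms with unit Gram matrix computes the norm of the loop momenta. -/
theorem sum_mul_norm_sq {ι : Type*} [Fintype ι] [DecidableEq ι] {B : Matrix E ι ℝ} {a : E → ℝ}
    (hB : Bᵀ * Matrix.diagonal a * B = 1) (k : ι → EuclideanSpace ℝ (Fin d)) :
    ∑ e, a e * ‖∑ l, B e l • k l‖ ^ 2 = ∑ l, ‖k l‖ ^ 2 := by
  have h : ∀ l m, ∑ e, a e * (B e l * B e m) = (1 : Matrix ι ι ℝ) l m := by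
    intro l m
    rw [← hB, Matrix.mul_assoc, Matrix.mul_apply]
    simp only [Matrix.transpose_apply, Matrix.diagonal_mul]
    exact Finset.sum_congr rfl fun e _ => by ring
  simp only [← real_inner_self_eq_norm_sq, sum_inner, inner_sum, real_inner_smul_left,
    real_inner_smul_right, Finset.mul_sum]
  rw [Finset.sum_comm]
  refine Finset.sum_congr rfl fun l _ => ?_
  rw [Finset.sum_comm]
  have : ∀ m, ∑ e, a e * (B e l * (B e m * inner ℝ (k m) (k l))) =
      (1 : Matrix ι ι ℝ) l m * inner ℝ (k m) (k l) := by
    intro m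
    rw [← h, Finset.sum_mul]
    exact Finset.sum_congr rfl fun e _ => by ring
  simp only [this, Matrix.one_apply]
  simp

/-- Write `Λ = Pᵀ P` and substitute `k ↦ P⁻¹ k`: the exponent becomes `-∑ k_l²`, edge momenta
acquire the coefficients `B = C P⁻¹` with `B Bᵀ = C Λ⁻¹ Cᵀ`, and the Jacobian supplies `|det P|^d =
det Λ^(d/2)`. -/
theorem gaussianLoopIntegral_inner (hd : 0 < d) (c : Fin L → E → ℤ) {a : E → ℝ}
    (hΛ : (loopMatrix c a).PosDef) (i j : E) [Fintype S] (hS : Fintype.card S = 1) (s : S → E × E)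
    (hs : ∀ t, s t = (i, j)) :
    gaussianLoopIntegral d c 0 s 0 a =
      (d / 2 : ℝ) * (((cycleMatrix c).map (Int.cast : ℤ → ℝ) * (loopMatrix c a)⁻¹ *
        ((cycleMatrix c).map (Int.cast : ℤ → ℝ))ᵀ) j i / (loopMatrix c a).det ^ ((d : ℝ) / 2)) := by
  set C := (cycleMatrix c).map (Int.cast : ℤ → ℝ) with hC
  obtain ⟨P, hP⟩ := hΛ.posSemidef.exists_eq_transpose_mul_self
  have hdetΛ : (loopMatrix c a).det = |P.det| ^ 2 := by
    rw [hP, Matrix.det_mul, Matrix.det_transpose, sq_abs, sq]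
  have hdet : P.det ≠ 0 := by
    intro h0
    have := hΛ.det_pos
    rw [hdetΛ, h0] at this
    simp at this
  have hu : IsUnit P.det := hdet.isUnit
  set B := C * P⁻¹ with hB
  have hB1 : Bᵀ * Matrix.diagonal a * B = 1 := by
    have : Bᵀ * Matrix.diagonal a * B = (P⁻¹)ᵀ * loopMatrix c a * P⁻¹ := by
      rw [hB, loopMatrix, Matrix.transpose_mul]
      simp only [Matrix.mul_assoc, hC]
    rw [this, hP, Matrix.mul_assoc, Matrix.mul_assoc, Matrix.mul_nonsing_inv _ hu, Matrix.mul_one,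
      ← Matrix.transpose_mul, Matrix.mul_nonsing_inv _ hu, Matrix.transpose_one]
  have hBB : C * (loopMatrix c a)⁻¹ * Cᵀ = B * Bᵀ := by
    rw [hP, Matrix.mul_inv_rev, ← Matrix.transpose_nonsing_inv, hB, Matrix.transpose_mul]
    simp only [Matrix.mul_assoc]
  have hnum : ∀ Q : E → EuclideanSpace ℝ (Fin d),
      momentumNumerator d s Q = inner ℝ (Q i) (Q j) := by
    intro Q
    simp only [momentumNumerator, hs, Finset.prod_const, Finset.card_univ, hS, pow_one]
  have hdet' : (P⁻¹).det ≠ 0 := by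
    rw [Matrix.det_nonsing_inv, Ring.inverse_eq_inv']
    exact inv_ne_zero hdet
  have hI := integral_comp_loopMap (d := d) hdet' fun k =>
    momentumNumerator d s (edgeMomentum d c 0 0 k) *
      Real.exp (-∑ e, a e * ‖edgeMomentum d c 0 0 k e‖ ^ 2)
  simp only [hnum, edgeMomentum_loopMap_real, ← hC, ← hB, sum_mul_norm_sq hB1] at hI
  rw [integral_inner_sum_mul_exp hd, Matrix.det_nonsing_inv, Ring.inverse_eq_inv', abs_inv,
    inv_pow, inv_inv, Fintype.card_fin] at hI
  have hpow : (loopMatrix c a).det ^ ((d : ℝ) / 2) = |P.det| ^ d := by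
    rw [hdetΛ, ← Real.rpow_natCast, ← Real.rpow_natCast, ← Real.rpow_mul (abs_nonneg _)]
    congr 1
    push_cast
    ring
  have hdot : (B * Bᵀ) j i = B i ⬝ᵥ B j := by
    rw [Matrix.mul_apply, dotProduct]
    exact Finset.sum_congr rfl fun l _ => mul_comm _ _
  simp only [gaussianLoopIntegral, hnum]
  rw [hpow, hBB, hdot]
  have hPd : 0 < |P.det| ^ d := by positivity
  have hpi : 0 < Real.pi ^ ((L : ℝ) * d / 2) := by positivity
  have hJ : ∫ k : Fin L → EuclideanSpace ℝ (Fin d), inner ℝ (edgeMomentum d c 0 0 k i)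
      (edgeMomentum d c 0 0 k j) * Real.exp (-∑ e, a e * ‖edgeMomentum d c 0 0 k e‖ ^ 2) =
      (B i ⬝ᵥ B j) * ((d / 2 : ℝ) * Real.pi ^ ((L : ℝ) * d / 2)) / |P.det| ^ d := by
    rw [eq_div_iff hPd.ne', hI]
    ring
  rw [hJ]
  field_simp

/-- The second moment `d/2` raises `Γ(d/2)` to `Γ(d/2 + 1)`; writing the entry of `C Λ⁻¹ Cᵀ` as
`U^{i,j} / U` raises the power of `U` by one. -/
theorem vacuumIntegrand_eq_dodgson {V : Type*} [Fintype V] [DecidableEq V] {G : FeynGraph V E}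
    (hG : G.Connected) (v₀ : V) (hd : 0 < d) (c : Module.Basis (Fin L) ℤ G.cycleLattice)
    {a : E → ℝ} (ha : ∀ e, 0 < a e) (i j : E) [Fintype S] (hS : Fintype.card S = 1) (s : S → E × E)
    (hs : ∀ t, s t = (i, j)) :
    0 < G.symanzik v₀ a ∧ vacuumIntegrand d (fun l => (c l : E → ℤ)) s a =
      Real.Gamma ((d : ℝ) / 2 + 1) *
        (G.dodgson v₀ i j a / G.symanzik v₀ a ^ ((d : ℝ) / 2 + 1)) := by
  have hΛ := loopMatrix_posDef hG v₀ c ha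
  have hU : 0 < G.symanzik v₀ a := by
    rw [symanzik_eq_det_loopMatrix hG v₀ c ha]
    exact hΛ.det_pos
  refine ⟨hU, ?_⟩
  rw [vacuumIntegrand, gaussianLoopIntegral_inner hd _ hΛ i j hS s hs,
    dodgson_eq_symanzik_mul hG v₀ c ha, ← symanzik_eq_det_loopMatrix hG v₀ c ha,
    Real.Gamma_add_one (by positivity), Real.rpow_add_one hU.ne']
  field_simp

end ScalarProduct

/-! ### The power law in the external momentum and its Gaussian average -/

section Residue

open FeynGraph

variable {E S : Type*} [Fintype E] [Fintype S] {L : ℕ} {d : ℕ}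

theorem integral_orthant_comp_smul {F : Type*} [Fintype F] (f : (F → ℝ) → ℝ) {r : ℝ}
    (hr : 0 < r) :
    ∫ a in {a : F → ℝ | ∀ e, 0 < a e}, f (r • a) =
      (r ^ Fintype.card F)⁻¹ * ∫ a in {a : F → ℝ | ∀ e, 0 < a e}, f a := by
  have h := Measure.integral_comp_smul (volume : Measure (F → ℝ))
    ({a : F → ℝ | ∀ e, 0 < a e}.indicator f) r
  rw [← integral_indicator measurableSet_orthant, ← integral_indicator measurableSet_orthant]
  rw [Module.finrank_pi, abs_of_pos (by positivity), smul_eq_mul] at h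
  rw [← h]
  congr 1
  funext a
  simp only [Set.indicator, Set.mem_ofPred_eq, Pi.smul_apply, smul_eq_mul,
    mul_pos_iff_of_pos_left hr]

theorem integrableOn_orthant_comp_smul {F : Type*} [Fintype F] {f : (F → ℝ) → ℝ}
    (hf : IntegrableOn f {a : F → ℝ | ∀ e, 0 < a e}) {r : ℝ} (hr : 0 < r) :
    IntegrableOn (fun a => f (r • a)) {a : F → ℝ | ∀ e, 0 < a e} := by
  rw [← integrable_indicator_iff measurableSet_orthant] at hf ⊢
  refine (hf.comp_smul hr.ne').congr (.of_forall fun a => ?_)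
  simp only [Set.indicator, Set.mem_ofPred_eq, Pi.smul_apply, smul_eq_mul,
    mul_pos_iff_of_pos_left hr]

theorem prod_smul_rpow {F : Type*} [Fintype F] (β : F → ℝ) {r : ℝ} (hr : 0 < r) {a : F → ℝ}
    (ha : ∀ e, 0 < a e) :
    ∏ e, (r • a) e ^ (β e - 1) =
      r ^ (∑ e, β e - Fintype.card F) * ∏ e, a e ^ (β e - 1) := by
  simp only [Pi.smul_apply, smul_eq_mul, Real.mul_rpow hr.le (ha _).le, Finset.prod_mul_distrib]
  rw [← Real.rpow_sum_of_pos hr]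
  simp

/-- The Schwinger integrand at an arbitrary momentum, by scaling and rotation. -/
theorem schwingerIntegrand_smul (c : Fin L → E → ℤ) (q : E → ℝ) (β : E → ℝ) (s : S → E × E)
    {β₀ : ℝ} (hβ₀ : β₀ + ∑ e, β e = ((L : ℝ) + 1) * (d / 2) + Fintype.card S)
    {p p' : EuclideanSpace ℝ (Fin d)} (hp : ‖p‖ = 1) (hp' : p' ≠ 0) {a : E → ℝ}
    (ha : ∀ e, 0 < a e) :
    schwingerIntegrand d c q β s p' a = (‖p'‖ ^ 2) ^ (β₀ - (d : ℝ) / 2) *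
      ((‖p'‖ ^ 2) ^ Fintype.card E * schwingerIntegrand d c q β s p (‖p'‖ ^ 2 • a)) := by
  have ht : 0 < ‖p'‖ := norm_pos_iff.2 hp'
  set t := ‖p'‖ with htdef
  have hnorm : ‖p‖ = ‖t⁻¹ • p'‖ := by
    rw [norm_smul, ← htdef, norm_inv, Real.norm_of_nonneg ht.le, inv_mul_cancel₀ ht.ne', hp]
  -- The reflection exchanging two vectors of equal norm serves as the isometry carrying `p` to the
  -- direction of `p'`.
  set O := (ℝ ∙ (p - t⁻¹ • p'))ᗮ.reflection with hO
  have hOp : p' = t • O p := by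
    rw [hO, Submodule.reflection_sub hnorm, smul_smul, mul_inv_cancel₀ ht.ne', one_smul]
  rw [schwingerIntegrand, schwingerIntegrand, hOp, gaussianLoopIntegral_smul _ _ _ ht,
    gaussianLoopIntegral_map, prod_smul_rpow β (by positivity) ha]
  -- Power counting: this is the relation defining `β₀`. The factor `(t²)^#E` is kept apart as the
  -- Jacobian of `a ↦ t² a`.
  have hpow : t ^ (L * d + 2 * Fintype.card S) = (t ^ 2) ^ (β₀ - (d : ℝ) / 2) *
      ((t ^ 2) ^ Fintype.card E * (t ^ 2) ^ (∑ e, β e - Fintype.card E)) := by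
    rw [← Real.rpow_natCast (t ^ 2) (Fintype.card E), ← Real.rpow_add (by positivity),
      ← Real.rpow_add (by positivity), ← Real.rpow_natCast t 2, ← Real.rpow_mul ht.le,
      ← Real.rpow_natCast]
    congr 1
    push_cast
    linarith
  rw [hpow]
  ring

theorem exists_norm_eq_one (hd : 0 < d) : ∃ p : EuclideanSpace ℝ (Fin d), ‖p‖ = 1 :=
  ⟨EuclideanSpace.single ⟨0, hd⟩ 1, by simp⟩

/-- The power law in the external momentum, for the Schwinger integrand composed with a positively
homogeneous function. -/
theorem setIntegral_schwinger (c : Fin L → E → ℤ) (q : E → ℝ) (β : E → ℝ) (s : S → E × E)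
    {β₀ : ℝ} (hβ₀ : β₀ + ∑ e, β e = ((L : ℝ) + 1) * (d / 2) + Fintype.card S) (g : ℝ → ℝ)
    (hg : ∀ t r, 0 < t → g (t * r) = t * g r)
    {p p' : EuclideanSpace ℝ (Fin d)} (hp : ‖p‖ = 1) (hp' : p' ≠ 0) :
    ∫ a in {a : E → ℝ | ∀ e, 0 < a e}, g (schwingerIntegrand d c q β s p' a) =
      (∫ a in {a : E → ℝ | ∀ e, 0 < a e}, g (schwingerIntegrand d c q β s p a)) *
        (‖p'‖ ^ 2) ^ (β₀ - (d : ℝ) / 2) := by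
  have ht : 0 < ‖p'‖ ^ 2 := by have := norm_pos_iff.2 hp'; positivity
  have : ∀ a ∈ {a : E → ℝ | ∀ e, 0 < a e}, g (schwingerIntegrand d c q β s p' a) =
      (‖p'‖ ^ 2) ^ (β₀ - (d : ℝ) / 2) * (‖p'‖ ^ 2) ^ Fintype.card E *
        g (schwingerIntegrand d c q β s p (‖p'‖ ^ 2 • a)) := by
    intro a ha
    rw [schwingerIntegrand_smul c q β s hβ₀ hp hp' ha, ← mul_assoc, hg _ _ (by positivity)]
  rw [setIntegral_congr_fun measurableSet_orthant this, integral_const_mul,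
    integral_orthant_comp_smul (fun a => g (schwingerIntegrand d c q β s p a)) ht]
  field_simp

/-- Integrands at nonzero momenta differ by a constant and a dilation of the parameters; the
comparison goes through a unit vector. -/
theorem SchwingerConvergent.of_ne_zero (hd : 0 < d) {c : Fin L → E → ℤ} {q : E → ℝ} {β : E → ℝ}
    {s : S → E × E} {p : EuclideanSpace ℝ (Fin d)} (h : SchwingerConvergent d c q β s p)
    (hp : p ≠ 0) {p' : EuclideanSpace ℝ (Fin d)} (hp' : p' ≠ 0) :
    SchwingerConvergent d c q β s p' := by
  obtain ⟨p₁, hp₁⟩ := exists_norm_eq_one hd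
  have hβ₀ : (((L : ℝ) + 1) * (d / 2) + Fintype.card S - ∑ e, β e) + ∑ e, β e =
    ((L : ℝ) + 1) * (d / 2) + Fintype.card S := by ring
  have hp₁0 : p₁ ≠ 0 := by rintro rfl; simp at hp₁
  have ht : 0 < ‖p‖ ^ 2 := by have := norm_pos_iff.2 hp; positivity
  have ht' : 0 < ‖p'‖ ^ 2 := by have := norm_pos_iff.2 hp'; positivity
  have h1 : SchwingerConvergent d c q β s p₁ := by
    have := integrableOn_orthant_comp_smul h (inv_pos.2 ht)
    rw [SchwingerConvergent]
    refine IntegrableOn.congr_fun (this.const_mul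
      ((‖p‖ ^ 2) ^ ((((L : ℝ) + 1) * (d / 2) + Fintype.card S - ∑ e, β e) - (d : ℝ) / 2) *
        (‖p‖ ^ 2) ^ Fintype.card E)⁻¹) (fun a ha => ?_) measurableSet_orthant
    have ha' : ∀ e, 0 < ((‖p‖ ^ 2)⁻¹ • a) e := fun e => mul_pos (inv_pos.2 ht) (ha e)
    rw [schwingerIntegrand_smul c q β s hβ₀ hp₁ hp ha', smul_smul, mul_inv_cancel₀ ht.ne', one_smul]
    field_simp
  have := integrableOn_orthant_comp_smul h1 ht'
  rw [SchwingerConvergent]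
  refine IntegrableOn.congr_fun (this.const_mul
      ((‖p'‖ ^ 2) ^ ((((L : ℝ) + 1) * (d / 2) + Fintype.card S - ∑ e, β e) - (d : ℝ) / 2) *
        (‖p'‖ ^ 2) ^ Fintype.card E)) (fun a ha => ?_) measurableSet_orthant
  rw [schwingerIntegrand_smul c q β s hβ₀ hp₁ hp' ha, mul_assoc]

theorem measurable_schwingerIntegrand (c : Fin L → E → ℤ) (q : E → ℝ) (β : E → ℝ) (s : S → E × E) :
    Measurable fun x : EuclideanSpace ℝ (Fin d) × (E → ℝ) =>
      schwingerIntegrand d c q β s x.1 x.2 :=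
  (Finset.measurable_fun_prod _ fun e _ =>
    ((measurable_pi_apply e).comp measurable_snd).pow_const _).mul
      (measurable_gaussianLoopIntegral c q s)

/-- Integration of the Schwinger representation against a Gaussian in the external momentum. -/
theorem gaussian_average_schwinger (hd : 0 < d) (c : Fin L → E → ℤ) (q : E → ℝ) (β : E → ℝ)
    (s : S → E × E) {β₀ : ℝ} (hβ : 0 < β₀)
    (hβ₀ : β₀ + ∑ e, β e = ((L : ℝ) + 1) * (d / 2) + Fintype.card S)
    {p : EuclideanSpace ℝ (Fin d)} (hp : ‖p‖ = 1) (h : SchwingerConvergent d c q β s p) :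
    (IntegrableOn (fun a => ∫ k : EuclideanSpace ℝ (Fin d), Real.exp (-‖k‖ ^ 2) *
      schwingerIntegrand d c q β s k a) {a : E → ℝ | ∀ e, 0 < a e}) ∧
    ∫ a in {a : E → ℝ | ∀ e, 0 < a e}, ∫ k : EuclideanSpace ℝ (Fin d), Real.exp (-‖k‖ ^ 2) *
      schwingerIntegrand d c q β s k a =
      (∫ a in {a : E → ℝ | ∀ e, 0 < a e}, schwingerIntegrand d c q β s p a) *
        (Real.pi ^ ((d : ℝ) / 2) * Real.Gamma β₀ / Real.Gamma ((d : ℝ) / 2)) := by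
  have : Nonempty (Fin d) := ⟨⟨0, hd⟩⟩
  have hp0 : p ≠ 0 := by rintro rfl; simp at hp
  set μ := (volume : Measure (E → ℝ)).restrict {a | ∀ e, 0 < a e} with hμ
  set f : EuclideanSpace ℝ (Fin d) → (E → ℝ) → ℝ := fun k a =>
    Real.exp (-‖k‖ ^ 2) * schwingerIntegrand d c q β s k a with hf
  have hmeas : Measurable (Function.uncurry f) :=
    (by fun_prop : Measurable fun x : EuclideanSpace ℝ (Fin d) × (E → ℝ) =>
      Real.exp (-‖x.1‖ ^ 2)).mul (measurable_schwingerIntegrand c q β s)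
  have hne : ∀ᵐ k : EuclideanSpace ℝ (Fin d), k ≠ 0 := by
    simp [ae_iff]
  have hrad := radial_gaussian hd hβ
  have hint : Integrable (Function.uncurry f) (volume.prod μ) := by
    rw [integrable_prod_iff hmeas.aestronglyMeasurable]
    constructor
    · filter_upwards [hne] with k hk
      exact (h.of_ne_zero hd hp0 hk).const_mul (Real.exp (-‖k‖ ^ 2))
    -- The integral of the absolute value obeys the same power law, so joint integrability reduces
    -- to that of the radial Gaussian, where `β₀ > 0` is needed.
    · refine (hrad.1.const_mul (∫ a in {a : E → ℝ | ∀ e, 0 < a e},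
        |schwingerIntegrand d c q β s p a|)).congr ?_
      filter_upwards [hne] with k hk
      simp only [Function.uncurry, hf, norm_mul, Real.norm_eq_abs, Real.abs_exp]
      rw [integral_const_mul, hμ, setIntegral_schwinger c q β s hβ₀ (fun r => |r|)
        (fun t r ht => by rw [abs_mul, abs_of_pos ht]) hp hk]
      ring
  refine ⟨hint.integral_prod_right, ?_⟩
  rw [← integral_integral_swap hint, ← hrad.2, ← integral_const_mul]
  refine integral_congr_ae ?_
  filter_upwards [hne] with k hk
  simp only [hf]
  rw [integral_const_mul, hμ, setIntegral_schwinger c q β s hβ₀ (fun r => r)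
    (fun t r ht => rfl) hp hk]
  ring

end Residue

/-! ### The residue as an integral over the completed graph -/

section Completion

open FeynGraph

variable {E S : Type*} [Fintype E] [Fintype S] {L : ℕ} {d : ℕ}

/-- The edges of a completed graph other than the added one. -/
def someEquiv (E : Type*) : E ≃ {x : Option E // x ≠ none} where
  toFun e := ⟨some e, by simp⟩
  invFun x := x.1.get (Option.isSome_iff_ne_none.2 x.2)
  left_inv _ := rfl
  right_inv x := by simp

theorem slicePoint_singleton_none [DecidableEq E] (a : {x : Option E // x ≠ none} → ℝ) :
    slicePoint {none} none a = fun x => x.elim 1 fun e => a (someEquiv E e) := by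
  funext x
  cases x with
  | none =>
    have : ∀ y : {x : Option E // x ≠ none}, ¬ (y.1 = none) := fun y => y.2
    simp [slicePoint, this]
  | some e => simp [slicePoint, someEquiv]

/-- The projective integral with the added edge's parameter fixed to `1`. -/
theorem delta_singleton_none [DecidableEq E] (f : (Option E → ℝ) → ℝ) :
    (DeltaIntegrable {none} none f ↔
      IntegrableOn (fun a : E → ℝ => f fun x => x.elim 1 a) {a | ∀ e, 0 < a e}) ∧
    deltaIntegral {none} none f = ∫ a in {a : E → ℝ | ∀ e, 0 < a e}, f fun x => x.elim 1 a := by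
  have hmp := volume_measurePreserving_piCongrLeft
    (fun _ : {x : Option E // x ≠ none} => ℝ) (someEquiv E)
  have hemb := (MeasurableEquiv.piCongrLeft
    (fun _ : {x : Option E // x ≠ none} => ℝ) (someEquiv E)).measurableEmbedding
  have hsp : ∀ a : E → ℝ, slicePoint {none} none (MeasurableEquiv.piCongrLeft
      (fun _ : {x : Option E // x ≠ none} => ℝ) (someEquiv E) a) = fun x => x.elim 1 a := by
    intro a
    rw [slicePoint_singleton_none]
    funext x
    cases x with
    | none => rfl
    | some e =>
      exact Equiv.piCongrLeft_apply_apply (fun _ : {x : Option E // x ≠ none} => ℝ)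
        (someEquiv E) a e
  have hpre : (MeasurableEquiv.piCongrLeft (fun _ : {x : Option E // x ≠ none} => ℝ)
      (someEquiv E)) ⁻¹' positiveSlice {none} none = {a : E → ℝ | ∀ e, 0 < a e} := by
    ext a
    simp only [positiveSlice, Set.mem_preimage, Set.mem_ofPred_eq, hsp, Option.forall]
    simp
  constructor
  · rw [DeltaIntegrable, ← hmp.integrableOn_comp_preimage hemb, hpre]
    simp only [Function.comp_def, hsp]
  · rw [deltaIntegral, ← hmp.setIntegral_preimage_emb hemb, hpre]
    simp only [hsp]

theorem gaussianLoopIntegral_zero_smul {F : Type*} [Fintype F] {L : ℕ} (c : Fin L → F → ℤ)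
    (s : S → F × F) {t : ℝ} (ht : 0 < t) (a : F → ℝ) :
    t ^ ((L : ℝ) * (d / 2) + Fintype.card S) * gaussianLoopIntegral d c 0 s 0 (t • a) =
      gaussianLoopIntegral d c 0 s 0 a := by
  have hsq : 0 < √t := Real.sqrt_pos.2 ht
  have h := gaussianLoopIntegral_smul c 0 s hsq (0 : EuclideanSpace ℝ (Fin d)) a
  rw [smul_zero, Real.sq_sqrt ht.le] at h
  rw [h]
  congr 1
  rw [Real.sqrt_eq_rpow, ← Real.rpow_natCast, ← Real.rpow_mul ht.le]
  congr 1
  push_cast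
  ring

/-- The integrand of the residue is homogeneous of the degree which makes it projective. -/
theorem residueIntegrand_smul {F : Type*} [Fintype F] {L : ℕ} (c : Fin L → F → ℤ)
    (s : S → F × F) {β : F → ℝ} (hβ : ∑ x, β x = (L : ℝ) * (d / 2) + Fintype.card S)
    {t : ℝ} (ht : 0 < t) {a : F → ℝ} (ha : ∀ x, 0 < a x) :
    t ^ Fintype.card F * ((∏ x, (t • a) x ^ (β x - 1)) * vacuumIntegrand d c s (t • a)) =
      (∏ x, a x ^ (β x - 1)) * vacuumIntegrand d c s a := by
  rw [prod_smul_rpow β ht ha, vacuumIntegrand, vacuumIntegrand,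
    ← gaussianLoopIntegral_zero_smul c s ht a, ← hβ]
  have : t ^ (∑ x, β x) = t ^ Fintype.card F * t ^ (∑ x, β x - Fintype.card F) := by
    rw [← Real.rpow_natCast, ← Real.rpow_add ht]
    congr 1
    ring
  rw [this]
  ring

theorem measurable_residueIntegrand {F : Type*} [Fintype F] {L : ℕ} (c : Fin L → F → ℤ)
    (s : S → F × F) (β : F → ℝ) :
    Measurable fun a : F → ℝ => (∏ x, a x ^ (β x - 1)) * vacuumIntegrand d c s a :=
  (Finset.measurable_fun_prod _ fun e _ => (measurable_pi_apply e).pow_const _).mul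
    (((measurable_gaussianLoopIntegral c 0 s).comp
      (measurable_const (a := (0 : EuclideanSpace ℝ (Fin d))).prodMk measurable_id)).const_mul _)

variable {V : Type*} [Fintype V] [DecidableEq V] [DecidableEq E] {G : FeynGraph V E}

/-- The vacuum integrand of the completed graph, by integration over the external momentum. -/
theorem vacuumIntegrand_completed (hG : G.Connected) {u w : V}
    (c : Module.Basis (Fin L) ℤ G.cycleLattice)
    (c' : Module.Basis (Fin (L + 1)) ℤ (G.completed u w).cycleLattice) {q : E → ℝ}
    (hq : (G.incidence ℝ)ᵀ *ᵥ q = Pi.single w 1 - Pi.single u 1) (s : S → E × E)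
    {a : Option E → ℝ} (ha : ∀ x, 0 < a x) :
    vacuumIntegrand d (fun l => (c' l : Option E → ℤ)) (fun t => (some (s t).1, some (s t).2)) a =
      Real.Gamma ((d : ℝ) / 2) * ((Real.pi ^ ((d : ℝ) / 2))⁻¹ *
        ∫ p : EuclideanSpace ℝ (Fin d), Real.exp (-(a none * ‖p‖ ^ 2)) *
          gaussianLoopIntegral d (fun l => (c l : E → ℤ)) q s p fun e => a (some e)) := by
  -- The comparison of cycle bases needs an integral flow, whereas `q` may be real. The two differ
  -- by a real circulation, removed at the end by rerouting.
  obtain ⟨z, hz⟩ := hG.exists_flow u w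
  obtain ⟨R, A, hRA, hR⟩ := exists_unimodular_completedCycles hG u w c c' hz
  obtain ⟨Y, hY⟩ := exists_left_inverse_cycleMatrix (hG.completed u w) u c'
  have hzR : (G.incidence ℝ)ᵀ *ᵥ (fun e => (z e : ℝ)) = Pi.single w 1 - Pi.single u 1 := by
    ext v
    have := congrArg (Int.cast : ℤ → ℝ) (congrFun hz v)
    rw [← incidence_map]
    simpa [Matrix.mulVec, dotProduct, Pi.single_apply, apply_ite (Int.cast : ℤ → ℝ)] using this
  obtain ⟨r, hr⟩ := exists_eq_mulVec_of_circulation hG u c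
    (z := q - fun e => (z e : ℝ)) (by rw [Matrix.mulVec_sub, hq, hzR, sub_self])
  have hY' : A.map (Int.cast : ℤ → ℝ) * Y *
      (cycleMatrix (completedCycles (fun l => (c l : E → ℤ)) z)).map (Int.cast : ℤ → ℝ) = 1 := by
    rw [hR, Matrix.map_intCast_mul, Matrix.mul_assoc, ← Matrix.mul_assoc Y, hY, Matrix.one_mul,
      ← Matrix.map_intCast_mul, mul_eq_one_comm.1 hRA,
      Matrix.map_one _ Int.cast_zero Int.cast_one]
  rw [vacuumIntegrand, ← gaussianLoopIntegral_basis_change _ _ R A hR hRA,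
    gaussianLoopIntegral_completedCycles _ _ hY' s ha]
  congr 3
  funext p
  rw [gaussianLoopIntegral_reroute (fun l => (c l : E → ℤ)) r (q := q)
    (q' := fun e => (z e : ℝ))]
  intro e
  have := congrFun hr e
  simp only [Pi.sub_apply, Matrix.mulVec, dotProduct, cycleMatrix, Matrix.map_apply,
    Matrix.of_apply] at this
  linarith

/-- The residue as a projective integral over the parameters of the completed graph. -/
theorem residue_eq_deltaIntegral (hG : G.Connected) {u w : V} (hd : 0 < d)
    (c : Module.Basis (Fin L) ℤ G.cycleLattice)
    (c' : Module.Basis (Fin (L + 1)) ℤ (G.completed u w).cycleLattice) {q : E → ℝ}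
    (hq : (G.incidence ℝ)ᵀ *ᵥ q = Pi.single w 1 - Pi.single u 1) (s : S → E × E)
    {β : Option E → ℝ} (hβ : ∀ x, 0 < β x)
    (hβ₀ : β none + ∑ e, β (some e) = ((L : ℝ) + 1) * (d / 2) + Fintype.card S)
    {p : EuclideanSpace ℝ (Fin d)} (hp : ‖p‖ = 1)
    (h : SchwingerConvergent d (fun l => (c l : E → ℤ)) q (fun e => β (some e)) s p)
    (T : Finset (Option E)) (x₀ : Option E) (hx₀ : x₀ ∈ T) :
    DeltaIntegrable T x₀ (fun a => (∏ x, a x ^ (β x - 1)) *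
      vacuumIntegrand d (fun l => (c' l : Option E → ℤ))
        (fun t => (some (s t).1, some (s t).2)) a) ∧
    schwingerIntegral d (fun l => (c l : E → ℤ)) q (fun e => β (some e)) s p =
      (∏ x, Real.Gamma (β x))⁻¹ * deltaIntegral T x₀ (fun a => (∏ x, a x ^ (β x - 1)) *
        vacuumIntegrand d (fun l => (c' l : Option E → ℤ))
          (fun t => (some (s t).1, some (s t).2)) a) := by
  set f : (Option E → ℝ) → ℝ := fun a => (∏ x, a x ^ (β x - 1)) *
    vacuumIntegrand d (fun l => (c' l : Option E → ℤ))
      (fun t => (some (s t).1, some (s t).2)) a with hf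
  obtain ⟨hint, hval⟩ := gaussian_average_schwinger hd (fun l => (c l : E → ℤ)) q
    (fun e => β (some e)) s (hβ none) hβ₀ hp h
  have hfa : ∀ a ∈ {a : E → ℝ | ∀ e, 0 < a e}, f (fun x => x.elim 1 a) =
      Real.Gamma ((d : ℝ) / 2) * (Real.pi ^ ((d : ℝ) / 2))⁻¹ *
        ∫ k : EuclideanSpace ℝ (Fin d), Real.exp (-‖k‖ ^ 2) *
          schwingerIntegrand d (fun l => (c l : E → ℤ)) q (fun e => β (some e)) s k a := by
    intro a ha
    have ha' : ∀ x : Option E, 0 < x.elim 1 a := by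
      intro x
      cases x with
      | none => exact one_pos
      | some e => exact ha e
    simp only [hf]
    rw [vacuumIntegrand_completed hG c c' hq s ha', Fintype.prod_option]
    simp only [Option.elim, Real.one_rpow, one_mul, schwingerIntegrand]
    have : ∀ k : EuclideanSpace ℝ (Fin d), Real.exp (-‖k‖ ^ 2) *
        ((∏ e, a e ^ (β (some e) - 1)) *
          gaussianLoopIntegral d (fun l => (c l : E → ℤ)) q s k a) =
        (∏ e, a e ^ (β (some e) - 1)) * (Real.exp (-‖k‖ ^ 2) *
          gaussianLoopIntegral d (fun l => (c l : E → ℤ)) q s k a) := fun k => by ring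
    simp only [this]
    rw [integral_const_mul]
    ring
  -- On the slice `a₀ = 1` the Gaussian factor of the added edge is precisely the averaging weight
  -- `exp(-k²)`.
  have h0 : DeltaIntegrable {none} none f := by
    rw [(delta_singleton_none f).1]
    exact IntegrableOn.congr_fun (hint.const_mul _) (fun a ha => (hfa a ha).symm)
      measurableSet_orthant
  have hhom : ∀ t : ℝ, 0 < t → ∀ a : Option E → ℝ, (∀ x, 0 < a x) →
      t ^ Fintype.card (Option E) * f (t • a) = f a := by
    intro t ht a ha
    refine residueIntegrand_smul _ _ ?_ ht ha
    rw [Fintype.sum_option, hβ₀]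
    push_cast
    ring
  obtain ⟨h1, h2⟩ := deltaIntegral_independent (Finset.mem_singleton_self none) hx₀
    (measurable_residueIntegrand _ _ β) hhom h0
  refine ⟨h1, ?_⟩
  rw [h2, (delta_singleton_none f).2, setIntegral_congr_fun measurableSet_orthant hfa,
    integral_const_mul, hval, schwingerIntegral, Fintype.prod_option]
  have hΓ : Real.Gamma (β none) ≠ 0 := (Real.Gamma_pos_of_pos (hβ none)).ne'
  have hΓd : Real.Gamma ((d : ℝ) / 2) ≠ 0 := (Real.Gamma_pos_of_pos (by positivity)).ne'
  have hpi : Real.pi ^ ((d : ℝ) / 2) ≠ 0 := by positivity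
  field_simp

end Completion

/-! ### Proof of the theorem -/

theorem mainTheorem3 {V E S : Type*} [Fintype V] [Fintype E] [Fintype S]
    [DecidableEq V] [DecidableEq E]
    -- a connected graph, with external momentum entering at `u` and leaving at `w`
    (G : FeynGraph V E) (hG : G.Connected) (u w : V) (huw : u ≠ w)
    (d : ℕ) (hd : 0 < d) (L : ℕ)
    -- independent loops of the graph and of its completion, and a routing of the external momentum
    (c : Module.Basis (Fin L) ℤ G.cycleLattice)
    (c' : Module.Basis (Fin (L + 1)) ℤ (G.completed u w).cycleLattice)
    (q : E → ℝ) (hq : (G.incidence ℝ)ᵀ *ᵥ q = Pi.single w 1 - Pi.single u 1)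
    -- the numerator
    (s : S → E × E)
    -- the exponents `β (some e)` of the propagators, and `β_0 = β none`
    (β : Option E → ℝ) (hβ : ∀ x, 0 < β x)
    (hβ₀ : β none + ∑ e, β (some e) = ((L : ℝ) + 1) * (d / 2) + Fintype.card S) :
    -- the parametric representation computes the momentum space integral
    (∀ p : EuclideanSpace ℝ (Fin d),
      MomentumConvergent d (fun l => (c l : E → ℤ)) q (fun e => β (some e)) s p →
        SchwingerConvergent d (fun l => (c l : E → ℤ)) q (fun e => β (some e)) s p ∧
        momentumIntegral d (fun l => (c l : E → ℤ)) q (fun e => β (some e)) s p =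
          schwingerIntegral d (fun l => (c l : E → ℤ)) q (fun e => β (some e)) s p) ∧
    -- the integral is the residue `R` times a power of `p²`, and `R` is given by the completed graph
    ((∃ p : EuclideanSpace ℝ (Fin d), p ≠ 0 ∧
        SchwingerConvergent d (fun l => (c l : E → ℤ)) q (fun e => β (some e)) s p) →
      ∃ R : ℝ,
        (∀ p : EuclideanSpace ℝ (Fin d), p ≠ 0 →
          SchwingerConvergent d (fun l => (c l : E → ℤ)) q (fun e => β (some e)) s p ∧
          schwingerIntegral d (fun l => (c l : E → ℤ)) q (fun e => β (some e)) s p =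
            R * (‖p‖ ^ 2) ^ (β none - (d : ℝ) / 2)) ∧
        (∀ (T : Finset (Option E)) (x₀ : Option E), x₀ ∈ T →
          DeltaIntegrable T x₀ (fun a => (∏ x, a x ^ (β x - 1)) *
            vacuumIntegrand d (fun l => (c' l : Option E → ℤ))
              (fun t => (some (s t).1, some (s t).2)) a) ∧
          R = (∏ x, Real.Gamma (β x))⁻¹ *
            deltaIntegral T x₀ (fun a => (∏ x, a x ^ (β x - 1)) *
              vacuumIntegrand d (fun l => (c' l : Option E → ℤ))
                (fun t => (some (s t).1, some (s t).2)) a)) ∧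
        -- a single scalar product
        (∀ i j : E, Fintype.card S = 1 → (∀ t, s t = (i, j)) → ∀ v₀ : V,
          (∀ a : Option E → ℝ, (∀ x, 0 < a x) →
            0 < (G.completed u w).symanzik v₀ a ∧
            vacuumIntegrand d (fun l => (c' l : Option E → ℤ))
              (fun t => (some (s t).1, some (s t).2)) a =
              Real.Gamma ((d : ℝ) / 2 + 1) * ((G.completed u w).dodgson v₀ (some i) (some j) a /
                (G.completed u w).symanzik v₀ a ^ ((d : ℝ) / 2 + 1))) ∧
          ∀ (T : Finset (Option E)) (x₀ : Option E), x₀ ∈ T →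
            DeltaIntegrable T x₀ (fun a => (∏ x, a x ^ (β x - 1)) *
              ((G.completed u w).dodgson v₀ (some i) (some j) a /
                (G.completed u w).symanzik v₀ a ^ ((d : ℝ) / 2 + 1))) ∧
            R = Real.Gamma ((d : ℝ) / 2 + 1) / (∏ x, Real.Gamma (β x)) *
              deltaIntegral T x₀ (fun a => (∏ x, a x ^ (β x - 1)) *
                ((G.completed u w).dodgson v₀ (some i) (some j) a /
                  (G.completed u w).symanzik v₀ a ^ ((d : ℝ) / 2 + 1))))) := by
  refine ⟨fun p h => schwinger_of_momentum _ q (fun e => hβ (some e)) s p h, ?_⟩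
  rintro ⟨p₀, hp₀, hconv⟩
  obtain ⟨p₁, hp₁⟩ := exists_norm_eq_one hd
  have hp₁0 : p₁ ≠ 0 := by rintro rfl; simp at hp₁
  have hconv₁ := hconv.of_ne_zero hd hp₀ hp₁0
  have hres := residue_eq_deltaIntegral hG hd c c' hq s hβ hβ₀ hp₁ hconv₁
  -- The residue is the value of the integral at a unit momentum.
  refine ⟨schwingerIntegral d (fun l => (c l : E → ℤ)) q (fun e => β (some e)) s p₁, ?_, hres, ?_⟩
  · intro p hp
    refine ⟨hconv.of_ne_zero hd hp₀ hp, ?_⟩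
    rw [schwingerIntegral, setIntegral_schwinger _ q _ s hβ₀ (fun r => r) (fun _ _ _ => rfl) hp₁ hp,
      schwingerIntegral, mul_assoc]
  · intro i j hS hs v₀
    have hU := fun (a : Option E → ℝ) (ha : ∀ x, 0 < a x) =>
      vacuumIntegrand_eq_dodgson (hG.completed u w) v₀ hd c' ha (some i) (some j) hS
        (fun t => (some (s t).1, some (s t).2)) fun t => by rw [hs t]
    refine ⟨hU, fun T x₀ hx₀ => ?_⟩
    obtain ⟨h1, h2⟩ := hres T x₀ hx₀
    have hsl : MeasurableSet (positiveSlice T x₀) :=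
      ((measurable_sumPoint T x₀).comp (measurable_const (a := (1 : ℝ)).prodMk measurable_id))
        measurableSet_orthant
    have hΓ : Real.Gamma ((d : ℝ) / 2 + 1) ≠ 0 := (Real.Gamma_pos_of_pos (by positivity)).ne'
    -- The determinantal formula is available for positive parameters, hence pointwise on the slice.
    have heq : Set.EqOn (fun b => (∏ x, slicePoint T x₀ b x ^ (β x - 1)) *
        vacuumIntegrand d (fun l => (c' l : Option E → ℤ))
          (fun t => (some (s t).1, some (s t).2)) (slicePoint T x₀ b))
        (fun b => Real.Gamma ((d : ℝ) / 2 + 1) * ((∏ x, slicePoint T x₀ b x ^ (β x - 1)) *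
          ((G.completed u w).dodgson v₀ (some i) (some j) (slicePoint T x₀ b) /
            (G.completed u w).symanzik v₀ (slicePoint T x₀ b) ^ ((d : ℝ) / 2 + 1))))
        (positiveSlice T x₀) := by
      intro b hb
      simp only
      rw [(hU _ hb).2]
      ring
    constructor
    · refine IntegrableOn.congr_fun (h1.const_mul (Real.Gamma ((d : ℝ) / 2 + 1))⁻¹)
        (fun b hb => ?_) hsl
      have := heq hb
      simp only at this
      simp only [this]
      rw [inv_mul_cancel_left₀ hΓ]
    · rw [h2, deltaIntegral, setIntegral_congr_fun hsl heq, integral_const_mul, deltaIntegral]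
      ring
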